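/- Let $X$, $Y$, $U$ be real Hilbert spaces. A map between normed spaces is called locally Lipschitz if it is Lipschitz continuous on every bounded set. Let $A:\mathcal D(A)\to X$ be the infinitesimal generator of a strongly continuous semigroup on $X$, with $\mathcal D(A)$ equipped with the graph norm; let $f:X\to X$, $g:X\to\mathcal L(U,X)$ and $h:X\to Y$ be locally Lipschitz with $f(0)=0$ and $h(0)=0$; let $C\in\mathcal L(\mathcal D(A),Y)$, and let $S\in\mathcal L(Y)$ satisfy $S^*=-S$. Call $V\in\mathcal C^1(X,\mathbb R)$ quadratic-like if there are $m_1,m_2>0$ with $m_1\|x\|_X^2\le V(x)\le m_2\|x\|_X^2$ for all $x\in X$. Assume: (1) There are a quadratic-like $V\in\mathcal C^1(X,\mathbb R)$ and $\beta>0$ such that $\mathrm dV(x)[Ax+f(x)+g(x)u]\le\beta\|u\|_U^2$ for all $x\in\mathcal D(A)$ and $u\in U$. Moreover, for every bounded open set $\mathcal B\subset X$ there are a quadratic-like $V_{\mathcal B}\in\mathcal C^1(X,\mathbb R)$ and $\alpha_{\mathcal B},\beta_{\mathcal B}>0$ such that $\mathrm dV_{\mathcal B}(x)[Ax+f(x)+g(x)u]\le-\alpha_{\mathcal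 B}V_{\mathcal B}(x)+\beta_{\mathcal B}\|u\|_U^2$ for all $x\in\mathcal D(A)\cap\mathcal B$ and $u\in U$. (2) $\mathcal M\in\mathcal C^1(X,Y)$ has a locally Lipschitz differential $\mathrm d\mathcal M$, satisfies $\mathcal M(0)=0$, and $\mathrm d\mathcal M(x)[Ax+f(x)]=S\mathcal M(x)+Cx+h(x)$ for all $x\in\mathcal D(A)$. Consider the closed-loop system $$\dot x=Ax+f(x)+g(x)u,\qquad \dot z=Sz+Cx+h(x),\qquad u=g(x)^*\,\mathrm d\mathcal M(x)^*[z-\mathcal M(x)].$$ Its mild solutions with initial datum $w_0=[x_0,z_0]$ are the functions $w=[x,z]\in\mathcal C(\mathbb R^+,X\times Y)$ such that $w(t)=e^{t\mathbb A}w_0+\int_0^te^{(t-s)\mathbb A}F(w(s))\,\mathrm ds$ for all $t\ge0$, where $\mathbb A=\begin{bmatrix}A&0\\C&0\end{bmatrix}$ has domain $\mathcal D(A)\times Y$ and generates a strongly continuous semigroup on $X\times Y$, and $F(x,z)=[f(x)+g(x)g(x)^*\mathrm d\mathcal M(x)^*(z-\mathcal M(x)),\;Sz+h(x)]$. Then $\mathbb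 A$ does generate a strongly continuous semigroup on $X\times Y$, and for every $[x_0,z_0]\in X\times Y$ there is a unique (global) mild solution $[x,z]\in\mathcal C(\mathbb R^+,X\times Y)$. If $[x_0,z_0]\in\mathcal D(A)\times Y$, then $[x,z]$ is a classical solution, with $[x,z]\in\mathcal C(\mathbb R^+,\mathcal D(A)\times Y)\cap\mathcal C^1(\mathbb R^+,X\times Y)$. Furthermore, for every $\tau>0$, the map $[x_0,z_0]\mapsto[x,z]$ is continuous from $X\times Y$ to $\mathcal C([0,\tau],X\times Y)$ equipped with the uniform norm. -/

import Mathlib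

open Topology Set Filter
open scoped NNReal

noncomputable section

/-- Strongly continuous (`C₀`) semigroups of bounded linear operators on a real normed space. -/
structure C0Semigroup (E : Type*) [NormedAddCommGroup E] [NormedSpace ℝ E] where
  /-- The operator at time `t`. -/
  op : ℝ≥0 → E →L[ℝ] E
  op_zero : op 0 = ContinuousLinearMap.id ℝ E
  op_add : ∀ s t : ℝ≥0, op (s + t) = (op s).comp (op t)
  continuous_orbit : ∀ x : E, Continuous fun t : ℝ≥0 => op t x

/-- The (possibly unbounded) operator `A` is the infinitesimal generator of the semigroup `T`:
`x ∈ D(A)` and `A x = y` if and only if `(T t x - x) / t → y` as `t → 0⁺`. -/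
def IsGenerator {E : Type*} [NormedAddCommGroup E] [NormedSpace ℝ E]
    (A : E →ₗ.[ℝ] E) (T : C0Semigroup E) : Prop :=
  ∀ x y : E, (x, y) ∈ A.graph ↔
    Tendsto (fun t : ℝ≥0 => (t : ℝ)⁻¹ • (T.op t x - x)) (𝓝[>] 0) (𝓝 y)

/-- Global mild solutions `w ∈ C(ℝ⁺, E)` of `w' = A w + F(w)`, `w(0) = w₀`: the operator `A`
generates a strongly continuous semigroup `T`, and for all `t ≥ 0`,
`w(t) = T(t) w₀ + ∫₀ᵗ T(t - s) F(w(s)) ds`. -/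
def IsMildSolution {E : Type*} [NormedAddCommGroup E] [NormedSpace ℝ E]
    (A : E →ₗ.[ℝ] E) (F : E → E) (w₀ : E) (w : C(ℝ≥0, E)) : Prop :=
  ∃ T : C0Semigroup E, IsGenerator A T ∧
    ∀ t : ℝ≥0, w t = T.op t w₀ +
      ∫ s in (0 : ℝ)..(t : ℝ), T.op ((t : ℝ) - s).toNNReal (F (w s.toNNReal))

/-- Lipschitz continuity on every bounded subset. -/
def LipschitzOnBounded {E₁ E₂ : Type*} [NormedAddCommGroup E₁] [NormedAddCommGroup E₂]
    (φ : E₁ → E₂) : Prop :=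
  ∀ B : Set E₁, Bornology.IsBounded B → ∃ K : ℝ≥0, LipschitzOnWith K φ B

/-- `C` is bounded from `D(A)`, equipped with the graph norm, to `Y`. -/
def IsBoundedRelTo {X Y : Type*} [NormedAddCommGroup X] [NormedSpace ℝ X]
    [NormedAddCommGroup Y] [NormedSpace ℝ Y]
    (A : X →ₗ.[ℝ] X) (C : A.domain →ₗ[ℝ] Y) : Prop :=
  ∃ c : ℝ, ∀ x : A.domain, ‖C x‖ ≤ c * (‖(x : X)‖ + ‖A x‖)

/-- A quadratic-like functional of class `C¹`. -/
def IsQuadraticLike {X : Type*} [NormedAddCommGroup X] [NormedSpace ℝ X] (V : X → ℝ) : Prop :=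
  ContDiff ℝ 1 V ∧ ∃ m₁ m₂ : ℝ, 0 < m₁ ∧ 0 < m₂ ∧
    ∀ x : X, m₁ * ‖x‖ ^ 2 ≤ V x ∧ V x ≤ m₂ * ‖x‖ ^ 2

/-- Semiglobal input-to-state stability of `x' = A x + f(x) + g(x) u`. -/
structure SemiglobalISS {X U : Type*} [NormedAddCommGroup X] [NormedSpace ℝ X]
    [NormedAddCommGroup U] [NormedSpace ℝ U]
    (A : X →ₗ.[ℝ] X) (f : X → X) (g : X → U →L[ℝ] X) : Prop where
  global : ∃ V : X → ℝ, IsQuadraticLike V ∧ ∃ β : ℝ, 0 < β ∧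
    ∀ (x : A.domain) (u : U), fderiv ℝ V (x : X) (A x + f x + g x u) ≤ β * ‖u‖ ^ 2
  semiglobal : ∀ B : Set X, IsOpen B → Bornology.IsBounded B →
    ∃ V : X → ℝ, IsQuadraticLike V ∧ ∃ α β : ℝ, 0 < α ∧ 0 < β ∧
      ∀ (x : A.domain) (u : U), (x : X) ∈ B →
        fderiv ℝ V (x : X) (A x + f x + g x u) ≤ -α * V x + β * ‖u‖ ^ 2

/-- The graph of `M` is invariant for the uncontrolled cascade. -/
structure IsInvariantGraph {X Y : Type*} [NormedAddCommGroup X] [NormedSpace ℝ X]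
    [NormedAddCommGroup Y] [NormedSpace ℝ Y]
    (A : X →ₗ.[ℝ] X) (f : X → X) (h : X → Y) (C : A.domain →ₗ[ℝ] Y) (S : Y →L[ℝ] Y)
    (M : X → Y) : Prop where
  contDiff : ContDiff ℝ 1 M
  lipschitz_fderiv : LipschitzOnBounded (fderiv ℝ M)
  map_zero : M 0 = 0
  sylvester : ∀ x : A.domain, fderiv ℝ M (x : X) (A x + f x) = S (M x) + (C x + h x)

section Cascade

variable {X Y U : Type*}
  [NormedAddCommGroup X] [InnerProductSpace ℝ X] [CompleteSpace X]
  [NormedAddCommGroup Y] [InnerProductSpace ℝ Y] [CompleteSpace Y]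
  [NormedAddCommGroup U] [InnerProductSpace ℝ U] [CompleteSpace U]

/-- The forwarding feedback `u = g(x)* dM(x)* [z - M(x)]`. -/
def forwardingFeedback (g : X → U →L[ℝ] X) (M : X → Y) (x : X) (z : Y) : U :=
  ContinuousLinearMap.adjoint (g x)
    (ContinuousLinearMap.adjoint (fderiv ℝ M x) (z - M x))

/-- The operator matrix `[A 0; C 0]` on `X × Y`, with domain `D(A) × Y`. -/
def cascadeOperator (A : X →ₗ.[ℝ] X) (C : A.domain →ₗ[ℝ] Y) : (X × Y) →ₗ.[ℝ] (X × Y) where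
  domain := A.domain.prod ⊤
  toFun := (A.toFun.prod C).comp
    (((LinearMap.fst ℝ X Y).domRestrict (A.domain.prod ⊤)).codRestrict A.domain
      fun p => p.2.1)

/-- The nonlinearity `F(x, z) = (f(x) + g(x) u, S z + h(x))`, with `u` the forwarding feedback. -/
def closedLoopNonlinearity (f : X → X) (g : X → U →L[ℝ] X) (h : X → Y) (S : Y →L[ℝ] Y)
    (M : X → Y) (w : X × Y) : X × Y :=
  (f w.1 + g w.1 (forwardingFeedback g M w.1 w.2), S w.2 + h w.1)

/-- Global mild solutions of the closed loop with initial datum `w₀`. -/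
def IsClosedLoopMildSolution (A : X →ₗ.[ℝ] X) (f : X → X) (g : X → U →L[ℝ] X) (h : X → Y)
    (C : A.domain →ₗ[ℝ] Y) (S : Y →L[ℝ] Y) (M : X → Y) (w₀ : X × Y)
    (w : C(ℝ≥0, X × Y)) : Prop :=
  IsMildSolution (cascadeOperator A C) (closedLoopNonlinearity f g h S M) w₀ w

/-- Global classical solutions `w = [x, z] ∈ C(ℝ⁺, D(A) × Y) ∩ C¹(ℝ⁺, X × Y)` of the closed loop
with initial datum `w₀`. Continuity for the graph norm of `D(A)` is continuity of `t ↦ x(t)` and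
of `t ↦ A x(t)` in `X`; the derivative at `t = 0` is one-sided. -/
def IsClosedLoopClassicalSolution (A : X →ₗ.[ℝ] X) (f : X → X) (g : X → U →L[ℝ] X) (h : X → Y)
    (C : A.domain →ₗ[ℝ] Y) (S : Y →L[ℝ] Y) (M : X → Y) (w₀ : X × Y)
    (w : C(ℝ≥0, X × Y)) : Prop :=
  w 0 = w₀ ∧
  ContDiffOn ℝ 1 (fun s : ℝ => w s.toNNReal) (Ici 0) ∧
  ∃ x : ℝ≥0 → A.domain, ∃ z : ℝ≥0 → Y,
    (∀ t, w t = ((x t : X), z t)) ∧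
    Continuous (fun t => ((x t : X), A (x t))) ∧
    Continuous z ∧
    ∀ t : ℝ≥0,
      HasDerivWithinAt (fun s : ℝ => (x s.toNNReal : X))
        (A (x t) + f (x t) + g (x t) (forwardingFeedback g M (x t) (z t))) (Ici 0) (t : ℝ) ∧
      HasDerivWithinAt (fun s : ℝ => z s.toNNReal)
        (S (z t) + C (x t) + h (x t)) (Ici 0) (t : ℝ)

end Cascade

end

/-!
The closed loop is a semilinear equation `w' = 𝔸 w + F(w)` on `X × Y` with `F` Lipschitz on bounded
sets. Three facts make it globally well posed.

*The linear part.* If `A` generates `T`, then `∫₀ᵗ T(s) x ds` lies in the domain of `A` and `A` maps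
it to `T(t) x - x`, so that `x ↦ C ∫₀ᵗ T(s) x ds` is a bounded operator although `C` is not. Hence
`(x, z) ↦ (T(t) x, z + C ∫₀ᵗ T(s) x ds)` is a strongly continuous semigroup, and its generator is
`𝔸` (`IsGenerator.cascadeOperator`). A generator determines its semigroup (`IsGenerator.op_eq`), so
the variation of constants formula is unambiguous.

*Regularity.* For a mild solution starting in the domain, comparison with its own time translates
shows that it is Lipschitz in time, and so is the forcing term `t ↦ F(w(t))`. A Lipschitz function
with values in a Hilbert space is the primitive of an integrable function, namely of a weak limit of
its difference quotients (`lipschitzIsPrimitive_of_hilbert`). By Fubini's theorem the Duhamel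
integral of such a primitive is `C¹` (`C0Semigroup.duhamel_eq_integral`), and a differentiable mild
solution is classical (`IsGenerator.mem_graph_of_hasDerivWithinAt`). No differentiability of `F` is
needed.

*A priori bounds.* Along classical solutions, `e = z - M(x)` satisfies `e' = S e - dM(x) g(x) u`.
Since `S` is skew-adjoint and `u = g(x)* dM(x)* e`, this gives `(‖e‖² / 2)' = -‖u‖²`, while
`V(x)' ≤ β ‖u‖²`. So `V(x) + (β / 2) ‖z - M(x)‖²` does not increase
(`forwardingFunctionalDeriv_nonpos`), and its sublevel sets are bounded.

These are combined by truncation: replacing `F` by `F ∘ P`, with `P` the radial retraction onto a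
large ball, makes the nonlinearity globally Lipschitz, so that global mild solutions exist
(`C0Semigroup.exists_isMild`). By the a priori bound, those starting in the domain never see the
truncation (`norm_le_of_isMild_truncated`); by density and continuous dependence neither do the
others (`exists_isMild_closedLoop`). Uniqueness and continuity with respect to the initial datum
follow from Gronwall's inequality on bounded sets (`C0Semigroup.exists_norm_sub_le`).
-/

/-! ### Strongly continuous semigroups -/

namespace C0Semigroup

variable {E : Type*} [NormedAddCommGroup E] [NormedSpace ℝ E]

/-- The semigroup with real time, frozen at the identity for negative times, so that orbits can be
differentiated and integrated along the real line. -/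
noncomputable def realOp (T : C0Semigroup E) (t : ℝ) : E →L[ℝ] E := T.op t.toNNReal

variable (T : C0Semigroup E)

@[simp] lemma realOp_coe (t : ℝ≥0) : T.realOp t = T.op t := by simp [realOp]

@[simp] lemma realOp_zero : T.realOp 0 = ContinuousLinearMap.id ℝ E := by
  simp [realOp, T.op_zero]

lemma realOp_add {s t : ℝ} (hs : 0 ≤ s) (ht : 0 ≤ t) (x : E) :
    T.realOp (s + t) x = T.realOp s (T.realOp t x) := by
  simp [realOp, Real.toNNReal_add hs ht, T.op_add]

lemma continuous_realOp_apply (x : E) : Continuous fun t : ℝ => T.realOp t x :=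
  (T.continuous_orbit x).comp continuous_real_toNNReal

variable [CompleteSpace E]

lemma exists_norm_op_le (τ : ℝ≥0) : ∃ m : ℝ, 1 ≤ m ∧ ∀ t ≤ τ, ‖T.op t‖ ≤ m := by
  obtain ⟨C, hC⟩ := banach_steinhaus (g := fun t : Icc (0 : ℝ≥0) τ => T.op t) (by
    intro x
    obtain ⟨C, hC⟩ := (isCompact_Icc (a := (0 : ℝ≥0)) (b := τ)).exists_bound_of_continuousOn
      (T.continuous_orbit x).continuousOn
    exact ⟨C, fun t => hC t t.2⟩)
  exact ⟨max 1 C, le_max_left _ _, fun t ht => (hC ⟨t, zero_le, ht⟩).trans (le_max_right _ _)⟩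

lemma exists_norm_realOp_le (τ : ℝ) : ∃ m : ℝ, 1 ≤ m ∧ ∀ t ≤ τ, ‖T.realOp t‖ ≤ m := by
  obtain ⟨m, hm, h⟩ := T.exists_norm_op_le τ.toNNReal
  exact ⟨m, hm, fun t ht => h _ (Real.toNNReal_le_toNNReal ht)⟩

/-- Exponential growth bound: a bound on the unit time interval propagates by the semigroup law. -/
lemma exists_norm_op_le_exp :
    ∃ m ω : ℝ, 1 ≤ m ∧ 0 ≤ ω ∧ ∀ t : ℝ≥0, ‖T.op t‖ ≤ m * Real.exp (ω * t) := by
  obtain ⟨m, hm, h⟩ := T.exists_norm_op_le 1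
  have hm0 : 0 < m := by linarith
  have key : ∀ n : ℕ, ∀ t : ℝ≥0, t ≤ 1 → ‖T.op (n + t)‖ ≤ m ^ (n + 1) := by
    intro n
    induction n with
    | zero => intro t ht; simpa using h t ht
    | succ n ih =>
      intro t ht
      have : ((n + 1 : ℕ) : ℝ≥0) + t = 1 + (n + t) := by push_cast; ring
      rw [this, T.op_add, pow_succ']
      exact (ContinuousLinearMap.opNorm_comp_le _ _).trans
        (mul_le_mul (h 1 le_rfl) (ih t ht) (norm_nonneg _) hm0.le)
  refine ⟨m, Real.log m, hm, Real.log_nonneg hm, fun t => ?_⟩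
  have hfl : (⌊t⌋₊ : ℝ≥0) ≤ t := Nat.floor_le zero_le
  have h1 := key ⌊t⌋₊ (t - ⌊t⌋₊) (by
    rw [tsub_le_iff_left]
    exact (Nat.lt_floor_add_one t).le)
  rw [add_tsub_cancel_of_le hfl] at h1
  refine h1.trans ?_
  rw [pow_succ']
  gcongr
  rw [← Real.rpow_natCast, Real.rpow_def_of_pos hm0]
  have : ((⌊t⌋₊ : ℕ) : ℝ) ≤ t := by exact_mod_cast hfl
  gcongr
  exact Real.log_nonneg hm

/-- Joint continuity in time and in the state: strong continuity and local boundedness. -/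
lemma continuous_realOp : Continuous fun p : ℝ × E => T.realOp p.1 p.2 := by
  rw [continuous_iff_continuousAt]
  rintro ⟨t, x⟩
  obtain ⟨m, hm, h⟩ := T.exists_norm_realOp_le (t + 1)
  rw [ContinuousAt, tendsto_iff_norm_sub_tendsto_zero]
  have h1 : Tendsto (fun p : ℝ × E => m * ‖p.2 - x‖ + ‖T.realOp p.1 x - T.realOp t x‖)
      (𝓝 (t, x)) (𝓝 0) := by
    have : Continuous fun p : ℝ × E => m * ‖p.2 - x‖ + ‖T.realOp p.1 x - T.realOp t x‖ := by
      have := (T.continuous_realOp_apply x).comp (continuous_fst (X := ℝ) (Y := E))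
      simp only [Function.comp_def] at this
      fun_prop
    simpa using this.tendsto (t, x)
  refine squeeze_zero' (Eventually.of_forall fun _ => norm_nonneg _) ?_ h1
  have hev : ∀ᶠ p : ℝ × E in 𝓝 (t, x), p.1 < t + 1 :=
    (continuous_fst.tendsto (t, x)).eventually (gt_mem_nhds (by simp))
  filter_upwards [hev] with p hp
  calc ‖T.realOp p.1 p.2 - T.realOp t x‖
      = ‖T.realOp p.1 (p.2 - x) + (T.realOp p.1 x - T.realOp t x)‖ := by
        rw [map_sub]; congr 1; abel
    _ ≤ _ := (norm_add_le _ _).trans (by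
        gcongr
        exact ((T.realOp p.1).le_opNorm _).trans (by gcongr; exact h _ hp.le))

lemma continuous_realOp_comp {α : Type*} [TopologicalSpace α] {r : α → ℝ} {φ : α → E}
    (hr : Continuous r) (hφ : Continuous φ) : Continuous fun a => T.realOp (r a) (φ a) :=
  T.continuous_realOp.comp (hr.prodMk hφ)

end C0Semigroup

/-! ### Generators -/

section Generator

variable {E : Type*} [NormedAddCommGroup E] [NormedSpace ℝ E]

/-- The generator expressed as the right derivative at time `0` of the orbits. -/
lemma isGenerator_iff_hasDerivWithinAt {A : E →ₗ.[ℝ] E} {T : C0Semigroup E} :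
    IsGenerator A T ↔ ∀ x y : E, (x, y) ∈ A.graph ↔
      HasDerivWithinAt (fun s : ℝ => T.realOp s x) y (Ici 0) 0 := by
  unfold IsGenerator
  refine forall₂_congr fun x y => iff_congr Iff.rfl ?_
  rw [hasDerivWithinAt_iff_tendsto_slope, Ici_sdiff_left, ← NNReal.coe_zero,
    ← NNReal.map_coe_nhdsGT, tendsto_map'_iff]
  simp [Function.comp_def, slope_def_module]

variable {A : E →ₗ.[ℝ] E} {T : C0Semigroup E}

lemma IsGenerator.hasDerivWithinAt (hA : IsGenerator A T) {x y : E} (h : (x, y) ∈ A.graph) :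
    HasDerivWithinAt (fun s : ℝ => T.realOp s x) y (Ici 0) 0 :=
  (isGenerator_iff_hasDerivWithinAt.1 hA x y).1 h

lemma IsGenerator.mem_graph (hA : IsGenerator A T) {x y : E}
    (h : HasDerivWithinAt (fun s : ℝ => T.realOp s x) y (Ici 0) 0) : (x, y) ∈ A.graph :=
  (isGenerator_iff_hasDerivWithinAt.1 hA x y).2 h

/-- Right derivatives can be computed at the origin after a translation of time. -/
lemma hasDerivWithinAt_Ici_iff_shift {φ : ℝ → E} {y : E} {t : ℝ} :
    HasDerivWithinAt φ y (Ici t) t ↔ HasDerivWithinAt (fun s => φ (t + s)) y (Ici 0) 0 := by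
  constructor
  · intro h
    have h2 : HasDerivWithinAt (fun s : ℝ => t + s) 1 (Ici 0) 0 :=
      ((hasDerivAt_id (0 : ℝ)).const_add t).hasDerivWithinAt
    have := HasDerivWithinAt.scomp (t' := Ici t) (h := fun s : ℝ => t + s) (0 : ℝ)
      (by simpa using h) h2 (fun s hs => by simpa using hs)
    simpa [Function.comp_def] using this
  · intro h
    have h2 : HasDerivWithinAt (fun s : ℝ => s - t) 1 (Ici t) t :=
      ((hasDerivAt_id t).sub_const t).hasDerivWithinAt
    have := HasDerivWithinAt.scomp (t' := Ici 0) (h := fun s : ℝ => s - t) t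
      (by simpa using h) h2 (fun s hs => by simpa using hs)
    simpa [Function.comp_def] using this

lemma HasDerivWithinAt.congr_Ici {φ ψ : ℝ → E} {y : E} {t : ℝ}
    (h : HasDerivWithinAt φ y (Ici t) t) (he : ∀ s, t ≤ s → ψ s = φ s) :
    HasDerivWithinAt ψ y (Ici t) t :=
  h.congr (fun s hs => he s hs) (he t le_rfl)

lemma IsGenerator.hasDerivWithinAt_orbit (hA : IsGenerator A T) {x y : E}
    (h : (x, y) ∈ A.graph) {t : ℝ} (ht : 0 ≤ t) :
    HasDerivWithinAt (fun s : ℝ => T.realOp s x) (T.realOp t y) (Ici t) t := by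
  rw [hasDerivWithinAt_Ici_iff_shift]
  refine ((T.realOp t).hasFDerivAt.comp_hasDerivWithinAt (0 : ℝ)
    (hA.hasDerivWithinAt h)).congr_Ici fun s hs => ?_
  simp [T.realOp_add ht hs]

lemma IsGenerator.realOp_mem_graph (hA : IsGenerator A T) {x y : E}
    (h : (x, y) ∈ A.graph) {t : ℝ} (ht : 0 ≤ t) : (T.realOp t x, T.realOp t y) ∈ A.graph := by
  refine hA.mem_graph ?_
  refine (hasDerivWithinAt_Ici_iff_shift.1 (hA.hasDerivWithinAt_orbit h ht)).congr_Ici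
    fun s hs => ?_
  rw [← T.realOp_add hs ht, add_comm]

/-- Two continuous functions with the same right derivative have the same increments. -/
lemma sub_eq_sub_of_hasDerivWithinAt_Ici {φ ψ φ' : ℝ → E} {a b : ℝ} (hab : a ≤ b)
    (hφ : ContinuousOn φ (Icc a b)) (hψ : ContinuousOn ψ (Icc a b))
    (h1 : ∀ t ∈ Ico a b, HasDerivWithinAt φ (φ' t) (Ici t) t)
    (h2 : ∀ t ∈ Ico a b, HasDerivWithinAt ψ (φ' t) (Ici t) t) : φ b - φ a = ψ b - ψ a := by
  have := constant_of_has_deriv_right_zero (f := fun t => φ t - ψ t) (hφ.sub hψ)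
    (fun t ht => by simpa using (h1 t ht).fun_sub (h2 t ht)) b (right_mem_Icc.2 hab)
  rw [sub_eq_sub_iff_sub_eq_sub]
  exact this

variable [CompleteSpace E]

/-- A continuous function with continuous right derivative is the integral of that derivative. -/
lemma sub_eq_integral_of_hasDerivWithinAt_Ici {φ φ' : ℝ → E} {b : ℝ} (hb : 0 ≤ b)
    (hφ : ContinuousOn φ (Icc 0 b)) (hφ' : Continuous φ')
    (h : ∀ t ∈ Ico 0 b, HasDerivWithinAt φ (φ' t) (Ici t) t) :
    φ b - φ 0 = ∫ s in (0 : ℝ)..b, φ' s := by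
  have hd : ∀ t, HasDerivAt (fun t => ∫ s in (0 : ℝ)..t, φ' s) (φ' t) t := fun t =>
    hφ'.integral_hasStrictDerivAt 0 t |>.hasDerivAt
  have := sub_eq_sub_of_hasDerivWithinAt_Ici hb hφ
    (fun t _ => (hd t).continuousAt.continuousWithinAt) h (fun t _ => (hd t).hasDerivWithinAt)
  simpa using this

lemma IsGenerator.realOp_sub_eq_integral (hA : IsGenerator A T) {x y : E}
    (h : (x, y) ∈ A.graph) {t : ℝ} (ht : 0 ≤ t) :
    T.realOp t x - x = ∫ s in (0 : ℝ)..t, T.realOp s y := by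
  have := sub_eq_integral_of_hasDerivWithinAt_Ici ht (T.continuous_realOp_apply x).continuousOn
    (T.continuous_realOp_apply y) fun s hs => hA.hasDerivWithinAt_orbit h hs.1
  simpa using this

/-- Time averages of orbits belong to the domain of the generator. -/
lemma IsGenerator.integral_mem_graph (hA : IsGenerator A T) (x : E) {t : ℝ} (ht : 0 ≤ t) :
    (∫ s in (0 : ℝ)..t, T.realOp s x, T.realOp t x - x) ∈ A.graph := by
  refine hA.mem_graph ?_
  have hc := T.continuous_realOp_apply x
  have hd : ∀ r, HasDerivAt (fun r => ∫ s in (0 : ℝ)..r, T.realOp s x) (T.realOp r x) r :=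
    fun r => (hc.integral_hasStrictDerivAt 0 r).hasDerivAt
  have h1 := hasDerivWithinAt_Ici_iff_shift.1 (hd t).hasDerivWithinAt
  have h2 : HasDerivWithinAt (fun r => ∫ s in (0 : ℝ)..r, T.realOp s x) x (Ici 0) 0 := by
    simpa using (hd 0).hasDerivWithinAt (s := Ici 0)
  refine (h1.sub h2).congr_Ici fun r hr => ?_
  rw [← ContinuousLinearMap.intervalIntegral_comp_comm _ (hc.intervalIntegrable _ _),
    Pi.sub_apply, intervalIntegral.integral_interval_sub_left (hc.intervalIntegrable _ _)
      (hc.intervalIntegrable _ _)]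
  have : ∫ s in (0 : ℝ)..t, (T.realOp r) (T.realOp s x) =
      ∫ s in (0 : ℝ)..t, T.realOp (r + s) x := by
    refine intervalIntegral.integral_congr fun s hs => ?_
    rw [uIcc_of_le ht] at hs
    exact (T.realOp_add hr hs.1 x).symm
  rw [this, intervalIntegral.integral_comp_add_left (fun s => T.realOp s x) r]
  simp [add_comm]

lemma IsGenerator.dense_domain (hA : IsGenerator A T) : Dense (A.domain : Set E) := by
  intro x
  have hd : HasDerivWithinAt (fun r => ∫ s in (0 : ℝ)..r, T.realOp s x) x (Ici 0) 0 := by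
    simpa using ((T.continuous_realOp_apply x).integral_hasStrictDerivAt 0 0).hasDerivAt
      |>.hasDerivWithinAt (s := Ici 0)
  rw [hasDerivWithinAt_iff_tendsto_slope, Ici_sdiff_left] at hd
  refine mem_closure_of_tendsto hd ?_
  filter_upwards [self_mem_nhdsWithin] with t ht
  have := (LinearPMap.mem_domain_of_mem_graph (hA.integral_mem_graph x (le_of_lt ht)))
  simpa [slope_def_module] using A.domain.smul_mem (t⁻¹) this

/-- The generator determines the semigroup: for `x` in the domain, `s ↦ T₁(t - s) T₂(s) x` has
vanishing right derivative. -/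
lemma IsGenerator.op_eq {T₁ T₂ : C0Semigroup E} (h₁ : IsGenerator A T₁) (h₂ : IsGenerator A T₂) :
    T₁.op = T₂.op := by
  funext t
  refine ContinuousLinearMap.coeFn_injective
    (Continuous.ext_on h₁.dense_domain (T₁.op t).continuous (T₂.op t).continuous fun x hx => ?_)
  have hxy : (x, A ⟨x, hx⟩) ∈ A.graph := A.mem_graph ⟨x, hx⟩
  set y := A ⟨x, hx⟩
  have hcont : Continuous fun s : ℝ => T₁.realOp (t - s) (T₂.realOp s x) :=
    T₁.continuous_realOp_comp (by fun_prop) (T₂.continuous_realOp_apply x)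
  have key := constant_of_has_deriv_right_zero (a := 0) (b := (t : ℝ)) hcont.continuousOn ?_ t
    (right_mem_Icc.2 t.2)
  · simpa using key.symm
  rintro s ⟨hs0, hst⟩
  rw [hasDerivWithinAt_Ici_iff_shift]
  have e1 := h₂.hasDerivWithinAt (h₂.realOp_mem_graph hxy hs0)
  have e2 := h₁.hasDerivWithinAt (h₂.realOp_mem_graph hxy hs0)
  have e3 := e1.sub e2
  rw [sub_self, hasDerivWithinAt_iff_tendsto_slope, Ici_sdiff_left] at e3
  rw [hasDerivWithinAt_iff_tendsto_slope, Ici_sdiff_left]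
  have e4 : Tendsto (fun r : ℝ => t - s - r) (𝓝[>] 0) (𝓝 (t - s)) := by
    have : Continuous fun r : ℝ => t - s - r := by fun_prop
    simpa using (this.tendsto 0).mono_left nhdsWithin_le_nhds
  have e5 := (T₁.continuous_realOp.tendsto (t - s, 0)).comp (e4.prodMk_nhds e3)
  simp only [map_zero] at e5
  refine e5.congr' ?_
  have hr : ∀ᶠ r : ℝ in 𝓝[>] 0, r < t - s :=
    (gt_mem_nhds (by linarith : (0 : ℝ) < t - s)).filter_mono nhdsWithin_le_nhds
  filter_upwards [self_mem_nhdsWithin, hr] with r hr0 hrt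
  have hr0 : 0 ≤ r := le_of_lt hr0
  -- The increment is `T₁(t - s - r)` applied to a quantity tending to `0` after division by `r`.
  have i1 : T₁.realOp (t - s) (T₂.realOp s x) =
      T₁.realOp (t - s - r) (T₁.realOp r (T₂.realOp s x)) := by
    rw [← T₁.realOp_add (by linarith) hr0]; congr 2; ring
  have i2 : T₂.realOp (s + r) x = T₂.realOp r (T₂.realOp s x) := by
    rw [← T₂.realOp_add hr0 hs0, add_comm]
  simp only [Function.comp_apply, slope_def_module, add_zero, sub_zero, Pi.sub_apply,
    T₁.realOp_zero, T₂.realOp_zero, ContinuousLinearMap.coe_id', id, sub_self]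
  rw [i1, i2, show (t : ℝ) - (s + r) = t - s - r by ring, map_smul, map_sub]

end Generator

/-! ### The semigroup generated by the cascade operator -/

section CascadeSemigroup

/-- An operator bounded for the graph norm is sequentially continuous for graph convergence. -/
lemma IsBoundedRelTo.tendsto {X Y α : Type*} [NormedAddCommGroup X] [NormedSpace ℝ X]
    [NormedAddCommGroup Y] [NormedSpace ℝ Y] {A : X →ₗ.[ℝ] X} {C : A.domain →ₗ[ℝ] Y}
    (hC : IsBoundedRelTo A C) {l : Filter α} {p : α → A.domain} {q : A.domain}
    (h1 : Tendsto (fun a => (p a : X)) l (𝓝 (q : X)))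
    (h2 : Tendsto (fun a => A (p a)) l (𝓝 (A q))) : Tendsto (fun a => C (p a)) l (𝓝 (C q)) := by
  obtain ⟨c, hc⟩ := hC
  rw [tendsto_iff_norm_sub_tendsto_zero] at h1 h2 ⊢
  have h3 := (h1.add h2).const_mul c
  rw [add_zero, mul_zero] at h3
  refine squeeze_zero (fun _ => norm_nonneg _) (fun a => ?_) h3
  have := hc (p a - q)
  rwa [map_sub, LinearPMap.map_sub, Submodule.coe_sub] at this

variable {X Y : Type*} [NormedAddCommGroup X] [InnerProductSpace ℝ X]
  [NormedAddCommGroup Y] [InnerProductSpace ℝ Y]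
  {A : X →ₗ.[ℝ] X} {T : C0Semigroup X} {C : A.domain →ₗ[ℝ] Y}

lemma mem_graph_cascadeOperator {w v : X × Y} :
    (w, v) ∈ (cascadeOperator A C).graph ↔
      ∃ p : A.domain, (p : X) = w.1 ∧ v = (A p, C p) := by
  rw [LinearPMap.mem_graph_iff]
  constructor
  · rintro ⟨q, hq, hv⟩
    exact ⟨⟨q.1.1, q.2.1⟩, congrArg Prod.fst hq, hv.symm⟩
  · rintro ⟨⟨x, hx⟩, hp, rfl⟩
    obtain ⟨x', z⟩ := w
    obtain rfl : x = x' := hp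
    exact ⟨⟨(x, z), hx, trivial⟩, rfl, rfl⟩

variable [CompleteSpace X]

/-- The map `x ↦ ∫₀ᵗ T(s) x ds` with values in the domain of the generator. -/
noncomputable def IsGenerator.averageMap (hA : IsGenerator A T) (t : ℝ≥0) : X →ₗ[ℝ] A.domain :=
  LinearMap.codRestrict A.domain
    { toFun := fun x => ∫ s in (0 : ℝ)..t, T.realOp s x
      map_add' := fun x y => by
        simp only [map_add]
        exact intervalIntegral.integral_add ((T.continuous_realOp_apply x).intervalIntegrable _ _)
          ((T.continuous_realOp_apply y).intervalIntegrable _ _)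
      map_smul' := fun c x => by
        simp only [map_smul, RingHom.id_apply]
        exact intervalIntegral.integral_smul c _ }
    fun x => LinearPMap.mem_domain_of_mem_graph (hA.integral_mem_graph x t.2)

lemma IsGenerator.coe_averageMap (hA : IsGenerator A T) (t : ℝ≥0) (x : X) :
    (hA.averageMap t x : X) = ∫ s in (0 : ℝ)..t, T.realOp s x := rfl

lemma IsGenerator.apply_averageMap (hA : IsGenerator A T) (t : ℝ≥0) (x : X) :
    A (hA.averageMap t x) = T.op t x - x := by
  obtain ⟨p, hp, hp'⟩ := (LinearPMap.mem_graph_iff A).1 (hA.integral_mem_graph x t.2)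
  have : hA.averageMap t x = p := Subtype.ext hp.symm
  rw [this, hp']
  simp [C0Semigroup.realOp]

lemma IsGenerator.averageMap_zero (hA : IsGenerator A T) (x : X) : hA.averageMap 0 x = 0 :=
  Subtype.ext (by simp [hA.coe_averageMap])

lemma IsGenerator.averageMap_add (hA : IsGenerator A T) (s t : ℝ≥0) (x : X) :
    hA.averageMap (s + t) x = hA.averageMap t x + hA.averageMap s (T.op t x) := by
  refine Subtype.ext ?_
  have hc := T.continuous_realOp_apply x
  simp only [Submodule.coe_add, hA.coe_averageMap]
  have : ∫ r in (0 : ℝ)..s, T.realOp r (T.op t x) = ∫ r in (0 : ℝ)..s, T.realOp (r + t) x := by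
    refine intervalIntegral.integral_congr fun r hr => ?_
    rw [uIcc_of_le s.coe_nonneg] at hr
    simp only [T.realOp_add hr.1 t.coe_nonneg, T.realOp_coe]
  rw [this, intervalIntegral.integral_comp_add_right (fun r => T.realOp r x), zero_add,
    intervalIntegral.integral_add_adjacent_intervals (hc.intervalIntegrable _ _)
      (hc.intervalIntegrable _ _), NNReal.coe_add]

/-- `C ∫₀ᵗ T(s) x ds` is controlled by the graph norm of the average, hence by `‖x‖`, since the
generator maps the average to `T(t) x - x`. -/
lemma IsGenerator.exists_norm_averageMap_le (hA : IsGenerator A T) (hC : IsBoundedRelTo A C)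
    (t : ℝ≥0) : ∃ k : ℝ, ∀ x, ‖(C ∘ₗ hA.averageMap t) x‖ ≤ k * ‖x‖ := by
  obtain ⟨c, hc⟩ := hC
  obtain ⟨m, hm, h⟩ := T.exists_norm_realOp_le t
  refine ⟨|c| * (m * t + (m + 1)), fun x => (hc _).trans ?_⟩
  have h1 : ‖(hA.averageMap t x : X)‖ ≤ m * t * ‖x‖ := by
    rw [hA.coe_averageMap]
    refine (intervalIntegral.norm_integral_le_of_norm_le_const (C := m * ‖x‖) fun s hs => ?_).trans
      (le_of_eq ?_)
    · rw [uIoc_of_le t.coe_nonneg] at hs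
      exact ((T.realOp s).le_opNorm x).trans (by gcongr; exact h s hs.2)
    · rw [sub_zero, abs_of_nonneg t.coe_nonneg]; ring
  have h2 : ‖A (hA.averageMap t x)‖ ≤ (m + 1) * ‖x‖ := by
    rw [hA.apply_averageMap, add_mul, one_mul]
    refine (norm_sub_le _ _).trans (add_le_add_left (((T.op t).le_opNorm x).trans ?_) _)
    gcongr
    simpa using h t le_rfl
  calc c * (‖(hA.averageMap t x : X)‖ + ‖A (hA.averageMap t x)‖)
      ≤ |c| * (m * t * ‖x‖ + (m + 1) * ‖x‖) :=
        mul_le_mul (le_abs_self c) (add_le_add h1 h2) (by positivity) (abs_nonneg c)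
    _ = _ := by ring

/-- The bounded operator `x ↦ C ∫₀ᵗ T(s) x ds`. -/
noncomputable def IsGenerator.outputMap (hA : IsGenerator A T) (hC : IsBoundedRelTo A C)
    (t : ℝ≥0) : X →L[ℝ] Y :=
  (C ∘ₗ hA.averageMap t).mkContinuousOfExistsBound (hA.exists_norm_averageMap_le hC t)

lemma IsGenerator.outputMap_apply (hA : IsGenerator A T) (hC : IsBoundedRelTo A C)
    (t : ℝ≥0) (x : X) : hA.outputMap hC t x = C (hA.averageMap t x) := rfl

lemma IsGenerator.continuous_outputMap (hA : IsGenerator A T) (hC : IsBoundedRelTo A C)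
    (x : X) : Continuous fun t => hA.outputMap hC t x := by
  rw [continuous_iff_continuousAt]
  intro t
  refine hC.tendsto (p := fun t => hA.averageMap t x) ?_ ?_
  · have := intervalIntegral.continuous_primitive (μ := MeasureTheory.volume)
      (fun a b => (T.continuous_realOp_apply x).intervalIntegrable a b) 0
    exact (this.comp NNReal.continuous_coe).tendsto t
  · simp only [hA.apply_averageMap]
    exact ((T.continuous_orbit x).sub continuous_const).tendsto t

/-- The semigroup `(x, z) ↦ (T(t) x, z + C ∫₀ᵗ T(s) x ds)`. -/
noncomputable def IsGenerator.cascadeSemigroup (hA : IsGenerator A T) (hC : IsBoundedRelTo A C) :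
    C0Semigroup (X × Y) where
  op t := ((T.op t).comp (ContinuousLinearMap.fst ℝ X Y)).prod
    (ContinuousLinearMap.snd ℝ X Y + (hA.outputMap hC t).comp (ContinuousLinearMap.fst ℝ X Y))
  op_zero := by
    ext w <;> simp [T.op_zero, hA.outputMap_apply, hA.averageMap_zero]
  op_add s t := by
    refine ContinuousLinearMap.ext fun w => Prod.ext ?_ ?_
    · simp [T.op_add]
    · simp [hA.outputMap_apply, hA.averageMap_add, add_assoc]
  continuous_orbit w := by
    have h1 := T.continuous_orbit w.1
    have h2 := hA.continuous_outputMap hC w.1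
    simp only [ContinuousLinearMap.prod_apply, ContinuousLinearMap.comp_apply,
      add_apply, ContinuousLinearMap.coe_fst', ContinuousLinearMap.coe_snd']
    fun_prop

/-- The cascade operator generates the cascade semigroup. The converse inclusion of graphs needs no
separate argument: the first component forces `x` into the domain of `A`, and right derivatives are
unique. -/
theorem IsGenerator.cascadeOperator (hA : IsGenerator A T) (hC : IsBoundedRelTo A C) :
    IsGenerator (cascadeOperator A C) (hA.cascadeSemigroup hC) := by
  rw [isGenerator_iff_hasDerivWithinAt]
  have key : ∀ (w : X × Y) (p : A.domain), (p : X) = w.1 →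
      HasDerivWithinAt (fun s : ℝ => (hA.cascadeSemigroup hC).realOp s w) (A p, C p) (Ici 0) 0 := by
    intro w p hp
    have h1 : HasDerivWithinAt (fun s : ℝ => T.realOp s w.1) (A p) (Ici 0) 0 :=
      hA.hasDerivWithinAt (hp ▸ A.mem_graph p)
    have h2 : HasDerivWithinAt (fun s : ℝ => hA.outputMap hC s.toNNReal w.1) (C p) (Ici 0) 0 := by
      have h3 := h1
      rw [hasDerivWithinAt_iff_tendsto_slope, Ici_sdiff_left] at h3 ⊢
      have h4 : HasDerivWithinAt (fun r => ∫ s in (0 : ℝ)..r, T.realOp s w.1) w.1 (Ici 0) 0 := by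
        simpa using ((T.continuous_realOp_apply w.1).integral_hasStrictDerivAt 0 0).hasDerivAt
          |>.hasDerivWithinAt (s := Ici 0)
      rw [hasDerivWithinAt_iff_tendsto_slope, Ici_sdiff_left] at h4
      have h5 := hC.tendsto (l := 𝓝[>] (0 : ℝ)) (q := p)
        (p := fun s : ℝ => s⁻¹ • hA.averageMap s.toNNReal w.1) ?_ ?_
      · refine h5.congr fun s => ?_
        simp [slope_def_module, hA.outputMap_apply, hA.averageMap_zero]
      · rw [hp]
        refine h4.congr' ?_
        filter_upwards [self_mem_nhdsWithin] with s hs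
        simp [slope_def_module, hA.coe_averageMap, Real.coe_toNNReal s (le_of_lt hs)]
      · refine h3.congr fun s => ?_
        rw [LinearPMap.map_smul, hA.apply_averageMap]
        simp [slope_def_module, C0Semigroup.realOp, T.op_zero]
    exact h1.prodMk (by simpa using h2.const_add w.2)
  intro w v
  rw [mem_graph_cascadeOperator]
  constructor
  · rintro ⟨p, hp, rfl⟩
    exact key w p hp
  · intro h
    have h1 : HasDerivWithinAt (fun s : ℝ => T.realOp s w.1) v.1 (Ici 0) 0 :=
      (ContinuousLinearMap.fst ℝ X Y).hasFDerivAt.comp_hasDerivWithinAt (0 : ℝ) h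
    obtain ⟨p, hp, -⟩ := (LinearPMap.mem_graph_iff A).1 (hA.mem_graph h1)
    exact ⟨p, hp, (uniqueDiffWithinAt_Ici 0).eq_deriv _ h (key w p hp)⟩

end CascadeSemigroup

/-! ### Lipschitz functions with values in a Hilbert space are primitives -/

section LipschitzPrimitive

open MeasureTheory

/-- Every Lipschitz function of a real variable with values in `E` is, on every interval `[0, τ]`,
the primitive of an integrable function (a form of the Radon–Nikodym property). The density is
normalised to vanish on the negative half-line. -/
def LipschitzIsPrimitive (E : Type*) [NormedAddCommGroup E] [NormedSpace ℝ E] : Prop :=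
  ∀ (φ : ℝ → E) (K : ℝ≥0), LipschitzWith K φ → ∀ τ : ℝ, ∃ ψ : ℝ → E,
    StronglyMeasurable ψ ∧ Integrable ψ ∧ (∀ s ≤ 0, ψ s = 0) ∧
      ∀ t ∈ Icc 0 τ, φ t - φ 0 = ∫ s in (0 : ℝ)..t, ψ s

/-- The density is a weak limit in `L²` of the difference quotients, which are uniformly bounded;
testing against indicator functions identifies its primitive. -/
lemma lipschitzIsPrimitive_of_hilbert (H : Type*) [NormedAddCommGroup H] [InnerProductSpace ℝ H]
    [CompleteSpace H] : LipschitzIsPrimitive H := by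
  intro φ K hφ τ
  set μ : Measure ℝ := volume.restrict (Ioc 0 τ) with hμ
  have hφc := hφ.continuous
  have hcn : ∀ n : ℕ, (0 : ℝ) < n + 1 := fun n => by positivity
  -- Difference quotients with step `1 / (n + 1)`.
  let q : ℕ → ℝ → H := fun n s => ((n : ℝ) + 1) • (φ (s + ((n : ℝ) + 1)⁻¹) - φ s)
  have hqc : ∀ n, Continuous (q n) := fun n => by fun_prop
  have hqK : ∀ n s, ‖q n s‖ ≤ K := by
    intro n s
    have := hφ.norm_sub_le (s + ((n : ℝ) + 1)⁻¹) s
    rw [add_sub_cancel_left, Real.norm_of_nonneg (inv_pos.2 (hcn n)).le] at this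
    rw [norm_smul, Real.norm_of_nonneg (hcn n).le]
    calc _ ≤ ((n : ℝ) + 1) * (K * ((n : ℝ) + 1)⁻¹) := by gcongr
      _ = K := by field_simp [(hcn n).ne']
  have hqL : ∀ n, MemLp (q n) 2 μ := fun n =>
    MemLp.of_bound (hqc n).aestronglyMeasurable K (Eventually.of_forall (hqK n))
  let Q : ℕ → Lp H 2 μ := fun n => (hqL n).toLp (q n)
  obtain ⟨R, hR⟩ : ∃ R : ℝ, ∀ n, ‖Q n‖ ≤ R := ⟨_, fun n => Lp.norm_le_of_ae_bound K.2 <| by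
    filter_upwards [(hqL n).coeFn_toLp] with s hs
    rw [hs]
    exact hqK n s⟩
  let ℓ : ℕ → WeakDual ℝ (Lp H 2 μ) := fun n =>
    StrongDual.toWeakDual (InnerProductSpace.toDual ℝ (Lp H 2 μ) (Q n))
  -- Banach–Alaoglu yields a weak limit along a free ultrafilter, represented by `p` below.
  obtain ⟨ℓ', -, hℓ'⟩ := (WeakDual.isCompact_closedBall
    (0 : StrongDual ℝ (Lp H 2 μ)) R).ultrafilter_le_nhds' ((hyperfilter ℕ).map ℓ) (by
      refine Ultrafilter.mem_map.2 (univ_mem' fun n => ?_)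
      simpa [ℓ] using hR n)
  have hlim : ∀ η : Lp H 2 μ, Tendsto (fun n => inner ℝ (Q n) η) (hyperfilter ℕ) (𝓝 (ℓ' η)) :=
    fun η => ((WeakDual.eval_continuous η).tendsto ℓ').comp (f := ℓ) hℓ'
  set p : Lp H 2 μ := (InnerProductSpace.toDual ℝ (Lp H 2 μ)).symm (WeakDual.toStrongDual ℓ')
  have hp : ∀ η : Lp H 2 μ, ℓ' η = inner ℝ p η := fun η => by
    rw [InnerProductSpace.toDual_symm_apply]; rfl
  have hpm : StronglyMeasurable (p : ℝ → H) := Lp.stronglyMeasurable p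
  have hpi : IntegrableOn (p : ℝ → H) (Ioc 0 τ) := (Lp.memLp p).integrable (by norm_num)
  refine ⟨(Ioc 0 τ).indicator p, hpm.indicator measurableSet_Ioc,
    hpi.integrable_indicator measurableSet_Ioc,
    fun s hs => indicator_of_notMem (fun h => absurd h.1 (not_lt.2 hs)) _, fun t ht => ?_⟩
  have hsub : Ioc 0 t ⊆ Ioc 0 τ := Ioc_subset_Ioc_right ht.2
  have hres : μ.restrict (Ioc 0 t) = volume.restrict (Ioc 0 t) := by
    rw [hμ, Measure.restrict_restrict measurableSet_Ioc, inter_eq_left.2 hsub]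
  have hint : ∫ s in (0 : ℝ)..t, (Ioc 0 τ).indicator p s = ∫ s in Ioc 0 t, p s ∂μ := by
    rw [intervalIntegral.integral_of_le ht.1, hres]
    exact setIntegral_congr_fun measurableSet_Ioc fun s hs => indicator_of_mem (hsub hs) _
  rw [hint]
  refine ext_inner_left ℝ fun e => ?_
  have hI := hlim (indicatorConstLp 2 measurableSet_Ioc (measure_ne_top μ (Ioc 0 t)) e)
  rw [hp, real_inner_comm, L2.inner_indicatorConstLp_eq_inner_setIntegral] at hI
  refine tendsto_nhds_unique ?_ hI
  have hd : ∀ a : ℝ, Tendsto (fun n : ℕ => ((n : ℝ) + 1) • ∫ s in a..a + ((n : ℝ) + 1)⁻¹, φ s)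
      atTop (𝓝 (φ a)) := by
    intro a
    have h1 := ((hφc.integral_hasStrictDerivAt a a).hasDerivAt).tendsto_slope
    have h2 : Tendsto (fun n : ℕ => a + ((n : ℝ) + 1)⁻¹) atTop (𝓝[≠] a) := by
      refine tendsto_nhdsWithin_iff.2 ⟨?_, Eventually.of_forall fun n => ?_⟩
      · simpa [one_div] using (tendsto_one_div_add_atTop_nhds_zero_nat (𝕜 := ℝ)).const_add a
      · simpa using (hcn n).ne'
    refine (h1.comp h2).congr fun n => ?_
    simp [slope_def_module]
  -- The integral of a difference quotient is a difference of averages near the end points.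
  have hq : ∀ n, ∫ s in (0 : ℝ)..t, q n s =
      ((n : ℝ) + 1) • (∫ s in t..t + ((n : ℝ) + 1)⁻¹, φ s) -
        ((n : ℝ) + 1) • ∫ s in (0 : ℝ)..0 + ((n : ℝ) + 1)⁻¹, φ s := by
    intro n
    have hi : ∀ a b, IntervalIntegrable φ volume a b := fun a b => hφc.intervalIntegrable a b
    rw [← smul_sub, intervalIntegral.integral_smul, intervalIntegral.integral_sub
      ((by fun_prop : Continuous fun s => φ (s + ((n : ℝ) + 1)⁻¹)).intervalIntegrable _ _) (hi _ _),
      intervalIntegral.integral_comp_add_right]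
    congr 1
    rw [intervalIntegral.integral_interval_sub_interval_comm' (hi _ _) (hi _ _) (hi _ _)]
  have h3 : Tendsto (fun n => ∫ s in (0 : ℝ)..t, q n s) atTop (𝓝 (φ t - φ 0)) := by
    simp only [hq]
    exact (hd t).sub (hd 0)
  have h4 := ((innerSL ℝ e).continuous.tendsto _).comp
    (h3.mono_left (Nat.hyperfilter_le_atTop))
  refine h4.congr fun n => ?_
  rw [real_inner_comm, L2.inner_indicatorConstLp_eq_inner_setIntegral]
  simp only [Function.comp_apply, innerSL_apply_apply]
  rw [intervalIntegral.integral_of_le ht.1, hres]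
  congr 1
  refine integral_congr_ae ?_
  rw [← hres]
  exact ae_restrict_of_ae (hqL n).coeFn_toLp.symm

lemma LipschitzIsPrimitive.prod {X Y : Type*} [NormedAddCommGroup X] [NormedSpace ℝ X]
    [NormedAddCommGroup Y] [NormedSpace ℝ Y] [CompleteSpace X] [CompleteSpace Y]
    (hX : LipschitzIsPrimitive X)
    (hY : LipschitzIsPrimitive Y) : LipschitzIsPrimitive (X × Y) := by
  intro φ K hφ τ
  obtain ⟨ψ₁, m₁, i₁, n₁, h₁⟩ := hX _ _ (LipschitzWith.prod_fst.comp hφ) τ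
  obtain ⟨ψ₂, m₂, i₂, n₂, h₂⟩ := hY _ _ (LipschitzWith.prod_snd.comp hφ) τ
  refine ⟨fun s => (ψ₁ s, ψ₂ s), m₁.prodMk m₂, i₁.prodMk i₂,
    fun s hs => by simp [n₁ s hs, n₂ s hs], fun t ht => ?_⟩
  have h1 := h₁ t ht
  have h2 := h₂ t ht
  rw [intervalIntegral.integral_of_le ht.1] at h1 h2 ⊢
  rw [integral_pair i₁.integrableOn i₂.integrableOn]
  exact Prod.ext h1 h2

end LipschitzPrimitive

/-! ### The Duhamel integral -/

section Duhamel

lemma ContinuousMap.continuous_comp_toNNReal {α : Type*} [TopologicalSpace α] (w : C(ℝ≥0, α)) :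
    Continuous fun s : ℝ => w s.toNNReal :=
  w.continuous.comp continuous_real_toNNReal

variable {E : Type*} [NormedAddCommGroup E] [NormedSpace ℝ E] (T : C0Semigroup E)

/-- The Duhamel integral `∫₀ᵗ T(t - s) φ(s) ds`. -/
noncomputable def C0Semigroup.duhamel (φ : ℝ → E) (t : ℝ) : E :=
  ∫ s in (0 : ℝ)..t, T.realOp (t - s) (φ s)

/-- The variation of constants formula for `w' = A w + F(w)`, `w(0) = w₀`, with `T` the semigroup
generated by `A`. -/
def C0Semigroup.IsMild (F : E → E) (w₀ : E) (w : C(ℝ≥0, E)) : Prop :=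
  ∀ t : ℝ≥0, w t = T.op t w₀ + T.duhamel (fun s => F (w s.toNNReal)) t

variable {T} in
lemma C0Semigroup.IsMild.apply_zero {F : E → E} {w₀ : E} {w : C(ℝ≥0, E)} (h : T.IsMild F w₀ w) :
    w 0 = w₀ := by
  have := h 0
  simpa [C0Semigroup.duhamel, T.op_zero] using this

lemma C0Semigroup.duhamel_congr {φ ψ : ℝ → E} {t : ℝ} (ht : 0 ≤ t)
    (h : ∀ s ∈ Icc 0 t, φ s = ψ s) : T.duhamel φ t = T.duhamel ψ t := by
  refine intervalIntegral.integral_congr fun s hs => ?_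
  rw [uIcc_of_le ht] at hs
  simp only [h s hs]

lemma C0Semigroup.norm_duhamel_le {φ : ℝ → E} {b : ℝ → ℝ} {m τ t : ℝ} (ht : 0 ≤ t) (htτ : t ≤ τ)
    (hm : ∀ s ≤ τ, ‖T.realOp s‖ ≤ m) (hb : Continuous b) (h : ∀ s ∈ Icc 0 t, ‖φ s‖ ≤ b s) :
    ‖T.duhamel φ t‖ ≤ m * ∫ s in (0 : ℝ)..t, b s := by
  rw [← intervalIntegral.integral_const_mul]
  refine intervalIntegral.norm_integral_le_of_norm_le ht
    (Eventually.of_forall fun s hs => ?_) ((hb.const_mul m).intervalIntegrable _ _)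
  have hm0 : 0 ≤ m := (norm_nonneg _).trans (hm 0 (ht.trans htτ))
  exact ((T.realOp (t - s)).le_opNorm _).trans
    (mul_le_mul (hm _ (by linarith [hs.1])) (h s ⟨hs.1.le, hs.2⟩) (norm_nonneg _) hm0)

variable [CompleteSpace E]

lemma C0Semigroup.continuous_duhamel_integrand {φ : ℝ → E} (hφ : Continuous φ) :
    Continuous fun p : ℝ × ℝ => T.realOp (p.1 - p.2) (φ p.2) :=
  T.continuous_realOp_comp (by fun_prop) (by fun_prop)

lemma C0Semigroup.intervalIntegrable_duhamel {φ : ℝ → E} (hφ : Continuous φ) (t a b : ℝ) :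
    IntervalIntegrable (fun s => T.realOp (t - s) (φ s)) MeasureTheory.volume a b :=
  ((T.continuous_duhamel_integrand hφ).comp (by fun_prop : Continuous fun s : ℝ => (t, s))
    ).intervalIntegrable a b

lemma C0Semigroup.continuous_duhamel {φ : ℝ → E} (hφ : Continuous φ) :
    Continuous (T.duhamel φ) :=
  intervalIntegral.continuous_parametric_intervalIntegral_of_continuous
    (f := fun t s => T.realOp (t - s) (φ s)) (T.continuous_duhamel_integrand hφ) continuous_id

lemma C0Semigroup.duhamel_sub {φ ψ : ℝ → E} (hφ : Continuous φ) (hψ : Continuous ψ) (t : ℝ) :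
    T.duhamel φ t - T.duhamel ψ t = T.duhamel (fun s => φ s - ψ s) t := by
  simp only [C0Semigroup.duhamel, map_sub]
  exact (intervalIntegral.integral_sub (T.intervalIntegrable_duhamel hφ t _ _)
    (T.intervalIntegrable_duhamel hψ t _ _)).symm

lemma C0Semigroup.duhamel_add {φ : ℝ → E} (hφ : Continuous φ) {t r : ℝ} (ht : 0 ≤ t)
    (hr : 0 ≤ r) : T.duhamel φ (t + r) =
      T.realOp r (T.duhamel φ t) + T.duhamel (fun s => φ (t + s)) r := by
  have hi := T.intervalIntegrable_duhamel hφ (t + r)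
  have h1 : T.realOp r (T.duhamel φ t) = ∫ s in (0 : ℝ)..t, T.realOp (t + r - s) (φ s) := by
    rw [C0Semigroup.duhamel, ← ContinuousLinearMap.intervalIntegral_comp_comm _
      (T.intervalIntegrable_duhamel hφ t _ _)]
    refine intervalIntegral.integral_congr fun s hs => ?_
    rw [uIcc_of_le ht] at hs
    rw [← T.realOp_add hr (by linarith [hs.2])]
    congr 2
    ring
  have h2 : T.duhamel (fun s => φ (t + s)) r = ∫ s in t..t + r, T.realOp (t + r - s) (φ s) := by
    have := intervalIntegral.integral_comp_add_left (a := 0) (b := r)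
      (fun s => T.realOp (t + r - s) (φ s)) t
    rw [add_zero] at this
    rw [← this]
    simp only [C0Semigroup.duhamel, add_sub_add_left_eq_sub]
  rw [h1, h2, C0Semigroup.duhamel, intervalIntegral.integral_add_adjacent_intervals (hi _ _)
    (hi _ _)]

lemma C0Semigroup.hasDerivAt_duhamel_zero {φ : ℝ → E} (hφ : Continuous φ) :
    HasDerivAt (T.duhamel φ) (φ 0) 0 := by
  rw [hasDerivAt_iff_isLittleO, Asymptotics.isLittleO_iff]
  intro ε hε
  have hG := (T.continuous_duhamel_integrand hφ).tendsto (0, 0)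
  simp only [sub_self, T.realOp_zero, ContinuousLinearMap.coe_id', id] at hG
  obtain ⟨δ, hδ, h⟩ := Metric.tendsto_nhds_nhds.1 hG ε hε
  filter_upwards [Metric.ball_mem_nhds (0 : ℝ) hδ] with t ht
  have ht' : |t| < δ := by simpa using ht
  have h1 : T.duhamel φ t - T.duhamel φ 0 - (t - 0) • φ 0 =
      ∫ s in (0 : ℝ)..t, (T.realOp (t - s) (φ s) - φ 0) := by
    rw [intervalIntegral.integral_sub (T.intervalIntegrable_duhamel hφ t _ _) (by simp)]
    simp [C0Semigroup.duhamel]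
  rw [h1, sub_zero, Real.norm_eq_abs]
  refine (intervalIntegral.norm_integral_le_of_norm_le_const (C := ε) fun s hs => ?_).trans
    (by simp)
  have hs' : |s| ≤ |t| := by
    rcases le_total 0 t with h0 | h0
    · rw [uIoc_of_le h0] at hs
      rw [abs_of_nonneg hs.1.le, abs_of_nonneg h0]; exact hs.2
    · rw [uIoc_of_ge h0] at hs
      rw [abs_of_nonpos hs.2, abs_of_nonpos h0]; linarith [hs.1]
  have := @h (t, s) (by
    rw [Prod.dist_eq]
    simpa using ⟨ht', hs'.trans_lt ht'⟩)
  rw [dist_eq_norm] at this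
  exact this.le

variable {T}

/-- Where a mild solution has a right derivative, it lies in the domain of the generator and
satisfies the differential equation. -/
lemma IsGenerator.mem_graph_of_hasDerivWithinAt {A : E →ₗ.[ℝ] E} (hA : IsGenerator A T)
    {φ W : ℝ → E} {x₀ y : E} (hφ : Continuous φ)
    (hW : ∀ t, 0 ≤ t → W t = T.realOp t x₀ + T.duhamel φ t) {t : ℝ} (ht : 0 ≤ t)
    (h : HasDerivWithinAt W y (Ici t) t) : (W t, y - φ t) ∈ A.graph := by
  refine hA.mem_graph ?_
  have h1 := T.hasDerivAt_duhamel_zero (φ := fun s => φ (t + s)) (by fun_prop)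
  simp only [add_zero] at h1
  refine ((hasDerivWithinAt_Ici_iff_shift.1 h).sub (h1.hasDerivWithinAt (s := Ici 0))).congr_Ici
    fun r hr => ?_
  rw [Pi.sub_apply, hW _ (add_nonneg ht hr), hW t ht, T.duhamel_add hφ ht hr, map_add,
    add_comm t r, T.realOp_add hr ht]
  abel

end Duhamel

/-! ### Maps that are Lipschitz on bounded sets -/

namespace LipschitzOnBounded

variable {E₁ E₂ E₃ : Type*} [NormedAddCommGroup E₁] [NormedAddCommGroup E₂] [NormedAddCommGroup E₃]

lemma continuous {φ : E₁ → E₂} (h : LipschitzOnBounded φ) : Continuous φ := by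
  rw [continuous_iff_continuousAt]
  intro x
  obtain ⟨K, hK⟩ := h (Metric.ball x 1) Metric.isBounded_ball
  exact hK.continuousOn.continuousAt (Metric.ball_mem_nhds x one_pos)

lemma isBounded_image {φ : E₁ → E₂} (h : LipschitzOnBounded φ) {B : Set E₁}
    (hB : Bornology.IsBounded B) : Bornology.IsBounded (φ '' B) := by
  obtain ⟨K, hK⟩ := h _ hB
  rw [← range_domRestrict, ← image_univ]
  refine hK.to_restrict.isBounded_image (Metric.isBounded_iff.2 ?_)
  obtain ⟨c, hc⟩ := Metric.isBounded_iff.1 hB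
  exact ⟨c, fun x _ y _ => hc x.2 y.2⟩

lemma exists_norm_le {φ : E₁ → E₂} (h : LipschitzOnBounded φ) {B : Set E₁}
    (hB : Bornology.IsBounded B) : ∃ k : ℝ≥0, ∀ x ∈ B, ‖φ x‖ ≤ k := by
  obtain ⟨R, hR⟩ := (h.isBounded_image hB).exists_norm_le
  exact ⟨R.toNNReal, fun x hx => (hR _ (mem_image_of_mem φ hx)).trans (Real.le_coe_toNNReal R)⟩

lemma of_lipschitzWith {φ : E₁ → E₂} {K : ℝ≥0} (h : LipschitzWith K φ) : LipschitzOnBounded φ :=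
  fun _ _ => ⟨K, h.lipschitzOnWith⟩

lemma comp {ψ : E₂ → E₃} {φ : E₁ → E₂} (hψ : LipschitzOnBounded ψ) (hφ : LipschitzOnBounded φ) :
    LipschitzOnBounded fun x => ψ (φ x) := by
  intro B hB
  obtain ⟨K, hK⟩ := hφ B hB
  obtain ⟨L, hL⟩ := hψ _ (hφ.isBounded_image hB)
  exact ⟨L * K, hL.comp hK (mapsTo_image φ B)⟩

lemma fst : LipschitzOnBounded (Prod.fst : E₁ × E₂ → E₁) := of_lipschitzWith LipschitzWith.prod_fst

lemma snd : LipschitzOnBounded (Prod.snd : E₁ × E₂ → E₂) := of_lipschitzWith LipschitzWith.prod_snd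

lemma prodMk {φ : E₁ → E₂} {ψ : E₁ → E₃} (hφ : LipschitzOnBounded φ) (hψ : LipschitzOnBounded ψ) :
    LipschitzOnBounded fun x => (φ x, ψ x) := by
  intro B hB
  obtain ⟨K, hK⟩ := hφ B hB
  obtain ⟨L, hL⟩ := hψ B hB
  exact ⟨max K L, hK.prodMk hL⟩

lemma add {φ ψ : E₁ → E₂} (hφ : LipschitzOnBounded φ) (hψ : LipschitzOnBounded ψ) :
    LipschitzOnBounded fun x => φ x + ψ x := by
  intro B hB
  obtain ⟨K, hK⟩ := hφ B hB
  obtain ⟨L, hL⟩ := hψ B hB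
  exact ⟨K + L, hK.add hL⟩

lemma sub {φ ψ : E₁ → E₂} (hφ : LipschitzOnBounded φ) (hψ : LipschitzOnBounded ψ) :
    LipschitzOnBounded fun x => φ x - ψ x := by
  intro B hB
  obtain ⟨K, hK⟩ := hφ B hB
  obtain ⟨L, hL⟩ := hψ B hB
  exact ⟨K + L, hK.sub hL⟩

lemma clm_apply [NormedSpace ℝ E₂] [NormedSpace ℝ E₃] {φ : E₁ → E₂ →L[ℝ] E₃} {ψ : E₁ → E₂}
    (hφ : LipschitzOnBounded φ) (hψ : LipschitzOnBounded ψ) :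
    LipschitzOnBounded fun x => φ x (ψ x) := by
  intro B hB
  obtain ⟨K, hK⟩ := hφ B hB
  obtain ⟨L, hL⟩ := hψ B hB
  obtain ⟨k, hk⟩ := hφ.exists_norm_le hB
  obtain ⟨l, hl⟩ := hψ.exists_norm_le hB
  refine ⟨k * L + K * l, LipschitzOnWith.of_dist_le_mul fun x hx y hy => ?_⟩
  rw [dist_eq_norm, dist_eq_norm]
  have h1 : φ x (ψ x) - φ y (ψ y) = φ x (ψ x - ψ y) + (φ x - φ y) (ψ y) := by
    rw [map_sub, sub_apply]; abel
  calc ‖φ x (ψ x) - φ y (ψ y)‖ ≤ ‖φ x‖ * ‖ψ x - ψ y‖ + ‖φ x - φ y‖ * ‖ψ y‖ := by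
        rw [h1]
        exact (norm_add_le _ _).trans
          (add_le_add ((φ x).le_opNorm _) ((φ x - φ y).le_opNorm _))
    _ ≤ k * (L * ‖x - y‖) + (K * ‖x - y‖) * l := by
        gcongr
        · exact hk x hx
        · exact hL.norm_sub_le hx hy
        · exact hK.norm_sub_le hx hy
        · exact hl y hy
    _ = _ := by push_cast; ring

lemma adjoint {H₁ H₂ : Type*} [NormedAddCommGroup H₁] [InnerProductSpace ℝ H₁] [CompleteSpace H₁]
    [NormedAddCommGroup H₂] [InnerProductSpace ℝ H₂] [CompleteSpace H₂] {φ : E₁ → H₁ →L[ℝ] H₂}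
    (hφ : LipschitzOnBounded φ) :
    LipschitzOnBounded fun x => ContinuousLinearMap.adjoint (φ x) :=
  (of_lipschitzWith (ContinuousLinearMap.adjoint (𝕜 := ℝ) (E := H₁)
    (F := H₂)).lipschitz).comp hφ

/-- By the mean value inequality on balls. -/
lemma of_fderiv [NormedSpace ℝ E₁] [NormedSpace ℝ E₂] {φ : E₁ → E₂} (hd : Differentiable ℝ φ)
    (h : LipschitzOnBounded (fderiv ℝ φ)) : LipschitzOnBounded φ := by
  intro B hB
  obtain ⟨r, hr⟩ := hB.subset_ball (0 : E₁)
  obtain ⟨k, hk⟩ := h.exists_norm_le (Metric.isBounded_ball (x := (0 : E₁)) (r := r))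
  exact ⟨k, ((convex_ball (0 : E₁) r).lipschitzOnWith_of_nnnorm_fderiv_le (𝕜 := ℝ)
    (fun x _ => hd x) fun x hx => hk x hx).mono hr⟩

end LipschitzOnBounded

/-! ### Mild solutions of semilinear equations -/

section Semilinear

/-- Grönwall's inequality in integral form. -/
lemma le_mul_exp_of_le_integral {u : ℝ → ℝ} (hu : Continuous u) {a b τ : ℝ} (hb : 0 ≤ b)
    (h : ∀ t ∈ Icc 0 τ, u t ≤ a + b * ∫ s in (0 : ℝ)..t, u s) :
    ∀ t ∈ Icc 0 τ, u t ≤ a * Real.exp (b * t) := by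
  have hd : ∀ t, HasDerivAt (fun t => a + b * ∫ s in (0 : ℝ)..t, u s) (b * u t) t := fun t =>
    ((hu.integral_hasStrictDerivAt 0 t).hasDerivAt.const_mul b).const_add a
  intro t ht
  have := le_gronwallBound_of_liminf_deriv_right_le (f := fun t => a + b * ∫ s in (0 : ℝ)..t, u s)
    (f' := fun t => b * u t) (δ := a) (K := b) (ε := 0) (a := 0) (b := τ)
    (fun t _ => (hd t).continuousAt.continuousWithinAt)
    (fun t _ r hr => (hd t).hasDerivWithinAt.liminf_right_slope_le hr) (by simp)
    (fun t ht => by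
      rw [add_zero]
      exact mul_le_mul_of_nonneg_left (h t ⟨ht.1, ht.2.le⟩) hb) t ht
  rw [gronwallBound_ε0, sub_zero] at this
  exact (h t ht).trans this

variable {E : Type*} [NormedAddCommGroup E] [NormedSpace ℝ E] [CompleteSpace E]
  {T : C0Semigroup E}

/-- Continuous dependence on the initial datum of mild solutions staying in a set on which the
nonlinearity is Lipschitz. -/
lemma C0Semigroup.IsMild.norm_sub_le {F : E → E} (hF : Continuous F) {K : ℝ≥0} {B : Set E}
    (hFB : LipschitzOnWith K F B) {m : ℝ} {τ : ℝ≥0} (hm : ∀ s ≤ (τ : ℝ), ‖T.realOp s‖ ≤ m)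
    {w₀ w₀' : E} {w w' : C(ℝ≥0, E)} (h : T.IsMild F w₀ w) (h' : T.IsMild F w₀' w')
    (hw : ∀ s ≤ τ, w s ∈ B) (hw' : ∀ s ≤ τ, w' s ∈ B) {t : ℝ≥0} (ht : t ≤ τ) :
    ‖w t - w' t‖ ≤ m * Real.exp (m * K * t) * ‖w₀ - w₀'‖ := by
  have hm0 : 0 ≤ m := (norm_nonneg _).trans (hm 0 τ.coe_nonneg)
  have c := w.continuous_comp_toNNReal
  have c' := w'.continuous_comp_toNNReal
  have key := le_mul_exp_of_le_integral (u := fun s => ‖w s.toNNReal - w' s.toNNReal‖)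
    (a := m * ‖w₀ - w₀'‖) (b := m * K) (τ := τ) (by fun_prop) (by positivity) ?_ t
    ⟨t.coe_nonneg, ht⟩
  · simp only [Real.toNNReal_coe] at key
    linarith
  rintro s ⟨hs0, hs⟩
  lift s to ℝ≥0 using hs0
  rw [Real.toNNReal_coe, h s, h' s, add_sub_add_comm, ← map_sub,
    T.duhamel_sub (φ := fun s => F (w s.toNNReal)) (ψ := fun s => F (w' s.toNNReal))
      (hF.comp c) (hF.comp c')]
  refine (norm_add_le _ _).trans (add_le_add ?_ ?_)
  · refine ((T.op s).le_opNorm _).trans ?_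
    gcongr
    simpa using hm s hs
  · rw [mul_assoc, ← intervalIntegral.integral_const_mul]
    refine T.norm_duhamel_le s.coe_nonneg hs hm (by fun_prop) fun r hr => ?_
    have hr' : r.toNNReal ≤ τ := Real.toNNReal_le_iff_le_coe.2 (hr.2.trans hs)
    exact hFB.norm_sub_le (hw _ hr') (hw' _ hr')

/-- A time translate of a mild solution is again a mild solution. -/
lemma C0Semigroup.IsMild.translate {F : E → E} (hF : Continuous F) {w₀ : E} {w : C(ℝ≥0, E)}
    (h : T.IsMild F w₀ w) (r : ℝ≥0) :
    T.IsMild F (w r) (w.comp ⟨fun t => r + t, by fun_prop⟩) := by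
  intro t
  simp only [ContinuousMap.comp_apply, ContinuousMap.coe_mk]
  rw [h (r + t), NNReal.coe_add, T.duhamel_add (φ := fun s => F (w s.toNNReal))
    (hF.comp w.continuous_comp_toNNReal) r.coe_nonneg t.coe_nonneg, T.realOp_coe, h r, map_add,
    add_comm r t, T.op_add, add_assoc,
    ContinuousLinearMap.comp_apply]
  congr 2
  refine T.duhamel_congr t.coe_nonneg fun s hs => ?_
  rw [Real.toNNReal_add r.coe_nonneg hs.1, Real.toNNReal_coe]

/-- Mild solutions starting in the domain of the generator are Lipschitz in time: compare the
solution with its time translates. -/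
lemma C0Semigroup.IsMild.exists_lipschitzOnWith {A : E →ₗ.[ℝ] E} (hA : IsGenerator A T) {F : E → E}
    (hF : Continuous F) {K : ℝ≥0} {B : Set E} (hFB : LipschitzOnWith K F B) {w₀ y : E}
    (hw₀ : (w₀, y) ∈ A.graph) {w : C(ℝ≥0, E)} (h : T.IsMild F w₀ w) {τ : ℝ≥0}
    (hw : ∀ s ≤ τ, w s ∈ B) :
    ∃ L : ℝ≥0, LipschitzOnWith L (fun s : ℝ => w s.toNNReal) (Icc 0 τ) := by
  obtain ⟨m, hm1, hm⟩ := T.exists_norm_realOp_le τ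
  have hm0 : 0 ≤ m := by linarith
  have c := w.continuous_comp_toNNReal
  obtain ⟨k, hk⟩ := (isCompact_Icc (a := (0 : ℝ)) (b := τ)).exists_bound_of_continuousOn
    (hF.comp c).continuousOn
  have hk0 : 0 ≤ k := (norm_nonneg _).trans (hk 0 ⟨le_rfl, τ.coe_nonneg⟩)
  have h1 : ∀ r ≤ τ, ‖w r - w₀‖ ≤ (m * ‖y‖ + m * k) * r := by
    intro r hr
    have hr' : (r : ℝ) ≤ τ := hr
    rw [h r, add_sub_right_comm, add_mul]
    refine (norm_add_le _ _).trans (add_le_add ?_ ?_)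
    · rw [← T.realOp_coe, hA.realOp_sub_eq_integral hw₀ r.coe_nonneg]
      refine (intervalIntegral.norm_integral_le_of_norm_le_const (C := m * ‖y‖)
        fun s hs => ?_).trans (by simp)
      rw [uIoc_of_le r.coe_nonneg] at hs
      exact ((T.realOp s).le_opNorm y).trans (by gcongr; exact hm s (hs.2.trans hr'))
    · refine (T.norm_duhamel_le (b := fun _ => k) r.coe_nonneg hr' hm continuous_const
        fun s hs => hk s ⟨hs.1, hs.2.trans hr'⟩).trans (le_of_eq ?_)
      simp only [intervalIntegral.integral_const, smul_eq_mul, sub_zero]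
      ring
  have h2 : ∀ s t : ℝ≥0, s ≤ t → t ≤ τ →
      ‖w t - w s‖ ≤ m * Real.exp (m * K * τ) * (m * ‖y‖ + m * k) * (t - s) := by
    intro s t hst ht
    obtain ⟨r, rfl⟩ := exists_add_of_le hst
    have hrτ : r ≤ τ := le_trans (le_add_of_nonneg_left zero_le) ht
    have hsr : s ≤ τ - r := le_tsub_of_add_le_right ht
    have := (h.translate hF r).norm_sub_le hF hFB (τ := τ - r)
      (fun q hq => hm q (hq.trans (NNReal.coe_le_coe.2 tsub_le_self))) h
      (fun q hq => hw _ (by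
        simp only [ContinuousMap.coe_mk]
        rw [add_comm]; exact (le_tsub_iff_right hrτ).1 hq))
      (fun q hq => hw _ (hq.trans tsub_le_self)) hsr
    simp only [ContinuousMap.comp_apply, ContinuousMap.coe_mk] at this
    rw [add_comm s r]
    refine this.trans ?_
    rw [NNReal.coe_add, add_sub_cancel_right, mul_assoc _ _ (r : ℝ)]
    gcongr
    · exact (le_add_of_nonneg_right zero_le).trans ht
    · exact h1 r hrτ
  have hL : 0 ≤ m * Real.exp (m * K * τ) * (m * ‖y‖ + m * k) := by positivity
  refine ⟨(m * Real.exp (m * K * τ) * (m * ‖y‖ + m * k)).toNNReal,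
    LipschitzOnWith.of_dist_le_mul ?_⟩
  rintro a ⟨ha0, ha⟩ b ⟨hb0, hb⟩
  lift a to ℝ≥0 using ha0
  lift b to ℝ≥0 using hb0
  simp only [Real.toNNReal_coe, dist_eq_norm, Real.norm_eq_abs, Real.coe_toNNReal _ hL]
  rcases le_total a b with hab | hab
  · rw [norm_sub_rev, abs_sub_comm, abs_of_nonneg (sub_nonneg.2 (NNReal.coe_le_coe.2 hab))]
    exact h2 a b hab hb
  · rw [abs_of_nonneg (sub_nonneg.2 (NNReal.coe_le_coe.2 hab))]
    exact h2 b a hab ha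

/-- The existential quantifier over semigroups in `IsMildSolution` is harmless, as the generator
determines the semigroup. -/
lemma isMildSolution_iff_isMild {A : E →ₗ.[ℝ] E} (hA : IsGenerator A T) {F : E → E}
    {w₀ : E} {w : C(ℝ≥0, E)} : IsMildSolution A F w₀ w ↔ T.IsMild F w₀ w := by
  constructor
  · rintro ⟨T', hT', h⟩ t
    rw [h t]
    simp only [C0Semigroup.duhamel, C0Semigroup.realOp, hT'.op_eq hA]
  · exact fun h => ⟨T, hA, h⟩

end Semilinear

section Existence

variable {E : Type*} [NormedAddCommGroup E] [NormedSpace ℝ E] [CompleteSpace E]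
  {T : C0Semigroup E}

open BoundedContinuousFunction in
/-- Global existence for a globally Lipschitz nonlinearity: after division by `exp (l t)`, with `l`
large, the variation of constants formula is a contraction of the space of bounded continuous
functions. -/
theorem C0Semigroup.exists_isMild (T : C0Semigroup E) {F : E → E} {K : ℝ≥0} (hF : LipschitzWith K F)
    (w₀ : E) : ∃ w : C(ℝ≥0, E), T.IsMild F w₀ w := by
  obtain ⟨m, ω, hm, hω, hT⟩ := T.exists_norm_op_le_exp
  have hm0 : 0 < m := by linarith
  -- The excess of `l` over the growth rate `ω` makes the contraction constant at most `1 / 2`.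
  set l : ℝ := ω + 2 * m * K + 1 with hl
  have hlω : 0 < l - ω := by
    have : 0 ≤ m * K := by positivity
    rw [hl]
    linarith
  have hl0 : 0 < l := by linarith
  have hexp : ∀ c t : ℝ, 0 ≤ c → 0 ≤ t → 1 ≤ Real.exp (c * t) := fun c t hc ht =>
    Real.one_le_exp (mul_nonneg hc ht)
  -- The Duhamel integral is bounded, in the weighted norm, by `m / (l - ω)`.
  have hD : ∀ (φ : ℝ → E) (c : ℝ) (t : ℝ≥0), 0 ≤ c →
      (∀ s ∈ Icc (0 : ℝ) t, ‖φ s‖ ≤ c * Real.exp (l * s)) →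
      ‖T.duhamel φ t‖ ≤ m * c / (l - ω) * Real.exp (l * t) := by
    intro φ c t hc h
    have hcont : Continuous fun s : ℝ => m * c * Real.exp (ω * t) * Real.exp ((l - ω) * s) := by
      fun_prop
    have h1 : ‖T.duhamel φ t‖ ≤
        ∫ s in (0 : ℝ)..t, m * c * Real.exp (ω * t) * Real.exp ((l - ω) * s) := by
      refine intervalIntegral.norm_integral_le_of_norm_le t.coe_nonneg
        (Eventually.of_forall fun s hs => ?_) (hcont.intervalIntegrable _ _)
      have hst : 0 ≤ (t : ℝ) - s := by linarith [hs.2]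
      have h2 := hT ((t : ℝ) - s).toNNReal
      rw [Real.coe_toNNReal _ hst] at h2
      calc _ ≤ (m * Real.exp (ω * (t - s))) * (c * Real.exp (l * s)) :=
            ((T.realOp (t - s)).le_opNorm _).trans
              (mul_le_mul h2 (h s ⟨hs.1.le, hs.2⟩) (norm_nonneg _) (by positivity))
        _ = m * c * (Real.exp (ω * (t - s)) * Real.exp (l * s)) := by ring
        _ = m * c * (Real.exp (ω * t) * Real.exp ((l - ω) * s)) := by
            rw [← Real.exp_add, ← Real.exp_add]; ring_nf
        _ = _ := by ring
    refine h1.trans ?_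
    have h3 : ∫ s in (0 : ℝ)..t, Real.exp ((l - ω) * s) =
        (l - ω)⁻¹ * (Real.exp ((l - ω) * t) - 1) := by
      rw [intervalIntegral.integral_comp_mul_left (fun s => Real.exp s) hlω.ne', integral_exp]
      simp
    rw [intervalIntegral.integral_const_mul, h3]
    have h4 : Real.exp (l * t) = Real.exp (ω * t) * Real.exp ((l - ω) * t) := by
      rw [← Real.exp_add]; ring_nf
    rw [h4, div_eq_mul_inv]
    calc _ ≤ m * c * Real.exp (ω * t) * ((l - ω)⁻¹ * Real.exp ((l - ω) * t)) := by
          gcongr; linarith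
      _ = _ := by ring
  -- The nonlinearity along the rescaled trajectory.
  let φ : (ℝ≥0 →ᵇ E) → ℝ → E := fun v s => F (Real.exp (l * s) • v s.toNNReal)
  have hφ : ∀ v, Continuous (φ v) := fun v => hF.continuous.comp
    ((by fun_prop : Continuous fun s : ℝ => Real.exp (l * s)).smul
      (v.continuous.comp continuous_real_toNNReal))
  have hφb : ∀ v, ∀ s : ℝ, 0 ≤ s → ‖φ v s‖ ≤ (‖F 0‖ + K * ‖v‖) * Real.exp (l * s) := by
    intro v s hs
    have h1 := hF.norm_sub_le (Real.exp (l * s) • v s.toNNReal) 0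
    rw [sub_zero, norm_smul, Real.norm_of_nonneg (Real.exp_pos _).le] at h1
    have h2 := norm_le_norm_add_norm_sub (F 0) (φ v s)
    have h3 : Real.exp (l * s) * ‖v s.toNNReal‖ ≤ Real.exp (l * s) * ‖v‖ := by
      gcongr; exact v.norm_coe_le_norm _
    have h4 : ‖F 0‖ * 1 ≤ ‖F 0‖ * Real.exp (l * s) := by gcongr; exact hexp l s hl0.le hs
    have h5 : (K : ℝ) * (Real.exp (l * s) * ‖v s.toNNReal‖) ≤ K * (Real.exp (l * s) * ‖v‖) := by
      gcongr
    have h6 : ‖F 0 - φ v s‖ ≤ K * (Real.exp (l * s) * ‖v s.toNNReal‖) := by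
      rw [norm_sub_rev]; exact h1
    linarith
  have hφs : ∀ v v', ∀ s : ℝ, ‖φ v s - φ v' s‖ ≤ (K * ‖v - v'‖) * Real.exp (l * s) := by
    intro v v' s
    refine (hF.norm_sub_le _ _).trans ?_
    rw [← smul_sub, norm_smul, Real.norm_of_nonneg (Real.exp_pos _).le, mul_assoc,
      mul_comm (Real.exp _)]
    gcongr
    exact (v - v').norm_coe_le_norm s.toNNReal
  have hneg : ∀ (t : ℝ≥0) (x : E) (c : ℝ), ‖x‖ ≤ c * Real.exp (l * t) →
      ‖Real.exp (-(l * t)) • x‖ ≤ c := by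
    intro t x c h
    rw [norm_smul, Real.norm_of_nonneg (Real.exp_pos _).le]
    calc _ ≤ Real.exp (-(l * t)) * (c * Real.exp (l * t)) := by gcongr
      _ = c * (Real.exp (-(l * t)) * Real.exp (l * t)) := by ring
      _ = c := by rw [← Real.exp_add]; simp
  let Γ : (ℝ≥0 →ᵇ E) → (ℝ≥0 →ᵇ E) := fun v => BoundedContinuousFunction.ofNormedAddCommGroup
    (fun t => Real.exp (-(l * t)) • (T.op t w₀ + T.duhamel (φ v) t))
    (by
      have h1 := (T.continuous_duhamel (hφ v)).comp NNReal.continuous_coe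
      have h2 := T.continuous_orbit w₀
      simp only [Function.comp_def] at h1
      fun_prop)
    (m * ‖w₀‖ + m * (‖F 0‖ + K * ‖v‖) / (l - ω))
    (fun t => by
      refine hneg t _ _ ((norm_add_le _ _).trans ?_)
      rw [add_mul]
      refine add_le_add ?_ (hD _ _ _ (by positivity) fun s hs => hφb v s hs.1)
      calc _ ≤ m * Real.exp (ω * t) * ‖w₀‖ :=
            ((T.op t).le_opNorm w₀).trans (by gcongr; exact hT t)
        _ = m * ‖w₀‖ * Real.exp (ω * t) := by ring
        _ ≤ _ := by gcongr; linarith)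
  have hΓ : ContractingWith (1 / 2) Γ := by
    refine ⟨by norm_num [← NNReal.coe_lt_coe], LipschitzWith.of_dist_le_mul fun v v' => ?_⟩
    rw [dist_eq_norm, dist_eq_norm, BoundedContinuousFunction.norm_le (by positivity)]
    intro t
    simp only [Γ, BoundedContinuousFunction.coe_sub, Pi.sub_apply,
      BoundedContinuousFunction.coe_ofNormedAddCommGroup]
    rw [← smul_sub, add_sub_add_left_eq_sub, T.duhamel_sub (hφ v) (hφ v')]
    refine hneg t _ _ ((hD _ _ t (by positivity) fun s _ => hφs v v' s).trans ?_)
    gcongr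
    rw [div_le_iff₀ hlω]
    have h8 : l - ω = 2 * m * K + 1 := by rw [hl]; ring
    rw [h8]
    push_cast
    nlinarith [norm_nonneg (v - v')]
  obtain ⟨v, hv⟩ : ∃ v, Γ v = v := ⟨_, hΓ.fixedPoint_isFixedPt⟩
  refine ⟨⟨fun t => Real.exp (l * t) • v t, by fun_prop⟩, fun t => ?_⟩
  have h1 : v t = Real.exp (-(l * t)) • (T.op t w₀ + T.duhamel (φ v) t) := by
    conv_lhs => rw [← hv]
    rfl
  simp only [ContinuousMap.coe_mk]
  rw [h1, smul_smul, ← Real.exp_add, add_neg_cancel, Real.exp_zero, one_smul]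
  congr 1
  refine T.duhamel_congr t.coe_nonneg fun s hs => ?_
  simp only [φ, Real.coe_toNNReal s hs.1]

end Existence

/-! ### Regularity of mild solutions -/

section Regularity

open MeasureTheory

variable {E : Type*} [NormedAddCommGroup E] [NormedSpace ℝ E] [CompleteSpace E]
  (T : C0Semigroup E)

omit [CompleteSpace E] in
lemma C0Semigroup.integral_realOp_comp_sub_eq {ψ : ℝ → E} (hψ0 : ∀ s ≤ 0, ψ s = 0) {t b : ℝ}
    (ht : t ∈ Icc 0 b) : ∫ σ in (0 : ℝ)..b, T.realOp σ (ψ (t - σ)) =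
      ∫ σ in (0 : ℝ)..t, T.realOp σ (ψ (t - σ)) := by
  rw [intervalIntegral.integral_of_le (ht.1.trans ht.2), intervalIntegral.integral_of_le ht.1]
  refine setIntegral_eq_of_subset_of_forall_sdiff_eq_zero measurableSet_Ioc
    (Ioc_subset_Ioc_right ht.2) fun s hs => ?_
  rw [hψ0 _ (by
    by_contra h
    exact hs.2 ⟨hs.1.1, by linarith⟩), map_zero]

/-- The convolution `∫₀ᵗ T(σ) ψ(t - σ) dσ` with an integrable function is continuous in `t`. -/
lemma C0Semigroup.continuousOn_integral_realOp_comp_sub {ψ : ℝ → E} (hψm : StronglyMeasurable ψ)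
    (hψ : Integrable ψ) {b : ℝ} :
    ContinuousOn (fun t => ∫ σ in (0 : ℝ)..t, T.realOp σ (ψ (t - σ))) (Icc 0 b) := by
  -- As `realOp` is the identity at negative times, the truncation `s ≤ t` can be removed.
  have key : ∀ t ∈ Icc 0 b, ∫ σ in (0 : ℝ)..t, T.realOp σ (ψ (t - σ)) =
      (∫ s in (0 : ℝ)..b, T.realOp (t - s) (ψ s)) - ∫ s in t..b, ψ s := by
    intro t ht
    obtain ⟨m, -, hm⟩ := T.exists_norm_realOp_le b
    have hi : ∀ c d, 0 ≤ c → 0 ≤ d →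
        IntervalIntegrable (fun s => T.realOp (t - s) (ψ s)) volume c d := by
      intro c d hc hd
      refine IntervalIntegrable.mono_fun' (g := fun s => m * ‖ψ s‖)
        ((hψ.norm.const_mul m).intervalIntegrable) ?_ ?_
      · exact (T.continuous_realOp.comp_stronglyMeasurable
          (((measurable_const.sub measurable_id).stronglyMeasurable (β := ℝ)).prodMk
            hψm)).aestronglyMeasurable
      · filter_upwards [ae_restrict_mem measurableSet_uIoc] with s hs
        have hs0 : 0 ≤ s := (le_min hc hd).trans hs.1.le
        exact ((T.realOp (t - s)).le_opNorm _).trans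
          (by gcongr; exact hm _ (by linarith [ht.2]))
    have h2 : ∫ σ in (0 : ℝ)..t, T.realOp σ (ψ (t - σ)) =
        ∫ s in (0 : ℝ)..t, T.realOp (t - s) (ψ s) := by
      have := intervalIntegral.integral_comp_sub_left (a := 0) (b := t)
        (fun s => T.realOp (t - s) (ψ s)) t
      simpa using this
    have h3 : ∫ s in t..b, T.realOp (t - s) (ψ s) = ∫ s in t..b, ψ s := by
      refine intervalIntegral.integral_congr fun s hs => ?_
      rw [uIcc_of_le ht.2] at hs
      simp [C0Semigroup.realOp, Real.toNNReal_of_nonpos (sub_nonpos.2 hs.1), T.op_zero]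
    rw [h2, ← h3, eq_sub_iff_add_eq, intervalIntegral.integral_add_adjacent_intervals
      (hi _ _ le_rfl ht.1) (hi _ _ ht.1 (ht.1.trans ht.2))]
  refine ContinuousOn.congr ?_ key
  refine ContinuousOn.sub ?_ ?_
  · intro t ht
    obtain ⟨m, hm1, hm⟩ := T.exists_norm_realOp_le (b + 1)
    refine (intervalIntegral.continuousAt_of_dominated_interval (bound := fun s => m * ‖ψ s‖)
      ?_ ?_ ((hψ.norm.const_mul m).intervalIntegrable) ?_).continuousWithinAt
    · exact Eventually.of_forall fun t => (T.continuous_realOp.comp_stronglyMeasurable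
          (((measurable_const.sub measurable_id).stronglyMeasurable (β := ℝ)).prodMk
            hψm)).aestronglyMeasurable
    · filter_upwards [gt_mem_nhds (lt_of_le_of_lt ht.2 (lt_add_one b))] with r hr
      refine Eventually.of_forall fun s hs => ?_
      rw [uIoc_of_le (ht.1.trans ht.2)] at hs
      exact ((T.realOp (r - s)).le_opNorm _).trans (by gcongr; exact hm _ (by linarith [hs.1]))
    · refine Eventually.of_forall fun s _ => ?_
      exact (T.continuous_realOp_comp (by fun_prop) continuous_const).continuousAt
  · have h1 := intervalIntegral.continuous_primitive (μ := volume) (f := ψ)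
      (fun c d => hψ.intervalIntegrable) b
    refine (h1.neg.congr fun t => ?_).continuousOn
    rw [Pi.neg_apply, intervalIntegral.integral_symm t b, neg_neg]

/-- If `φ` is the primitive of `ψ`, then the Duhamel integral of `φ` is the primitive of
`T(t) φ(0) + ∫ T(σ) ψ(t - σ) dσ`, by Fubini's theorem. -/
lemma C0Semigroup.duhamel_eq_integral {φ ψ : ℝ → E} (hφ : Continuous φ)
    (hψm : StronglyMeasurable ψ) (hψ : Integrable ψ) (hψ0 : ∀ s ≤ 0, ψ s = 0) {b : ℝ} (hb : 0 ≤ b)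
    (h : ∀ t ∈ Icc 0 b, φ t - φ 0 = ∫ s in (0 : ℝ)..t, ψ s) :
    T.duhamel φ b = ∫ t in (0 : ℝ)..b,
      (T.realOp t (φ 0) + ∫ σ in (0 : ℝ)..t, T.realOp σ (ψ (t - σ))) := by
  obtain ⟨m, hm1, hm⟩ := T.exists_norm_realOp_le b
  have hη := (T.continuousOn_integral_realOp_comp_sub hψm hψ (b := b))
  have hηi : IntervalIntegrable (fun t => ∫ σ in (0 : ℝ)..t, T.realOp σ (ψ (t - σ))) volume 0 b :=
    ContinuousOn.intervalIntegrable (by rwa [uIcc_of_le hb])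
  have hc := T.continuous_realOp_apply (φ 0)
  have hprod : Integrable (fun p : ℝ × ℝ => T.realOp p.2 (ψ (p.1 - p.2)))
      ((volume.restrict (Ioc 0 b)).prod (volume.restrict (Ioc 0 b))) := by
    have h1 : Integrable (fun p : ℝ × ℝ => m * ‖ψ (p.1 - p.2)‖)
        ((volume.restrict (Ioc 0 b)).prod (volume.restrict (Ioc 0 b))) := by
      have h2 := Integrable.convolution_integrand (ContinuousLinearMap.lsmul ℝ ℝ (E := E))
        (f := fun _ : ℝ => (1 : ℝ)) (ν := volume.restrict (Ioc 0 b)) (integrable_const _) hψ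
      simp only [ContinuousLinearMap.lsmul_apply, one_smul] at h2
      refine (h2.mono_measure ?_).norm.const_mul m
      exact Measure.prod_mono Measure.restrict_le_self le_rfl
    refine h1.mono' ?_ ?_
    · exact (T.continuous_realOp.comp_stronglyMeasurable
        (measurable_snd.stronglyMeasurable.prodMk
          (hψm.comp_measurable (measurable_fst.sub measurable_snd)))).aestronglyMeasurable
    · rw [Measure.prod_restrict]
      filter_upwards [ae_restrict_mem (measurableSet_Ioc.prod measurableSet_Ioc)] with p hp
      exact ((T.realOp p.2).le_opNorm _).trans (by gcongr; exact hm _ hp.2.2)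
  have hswap : ∫ t in (0 : ℝ)..b, ∫ σ in (0 : ℝ)..t, T.realOp σ (ψ (t - σ)) =
      ∫ σ in (0 : ℝ)..b, ∫ t in (0 : ℝ)..b, T.realOp σ (ψ (t - σ)) := by
    rw [intervalIntegral.integral_congr (g := fun t => ∫ σ in (0 : ℝ)..b, T.realOp σ (ψ (t - σ)))
      fun t ht => (T.integral_realOp_comp_sub_eq hψ0 (by rwa [uIcc_of_le hb] at ht)).symm]
    simp only [intervalIntegral.integral_of_le hb]
    exact integral_integral_swap hprod
  have hinner : ∀ σ ∈ Icc 0 b, ∫ t in (0 : ℝ)..b, T.realOp σ (ψ (t - σ)) =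
      T.realOp σ (φ (b - σ) - φ 0) := by
    intro σ hσ
    have hi : ∀ c d, IntervalIntegrable ψ volume c d := fun c d => hψ.intervalIntegrable
    rw [ContinuousLinearMap.intervalIntegral_comp_comm _
      ((hψ.comp_sub_right σ).intervalIntegrable),
      h _ ⟨by linarith [hσ.2], by linarith [hσ.1]⟩, intervalIntegral.integral_comp_sub_right,
      ← intervalIntegral.integral_add_adjacent_intervals (hi _ 0) (hi _ _)]
    have : ∫ s in (0 - σ)..0, ψ s = 0 := by
      rw [intervalIntegral.integral_congr (g := fun _ => (0 : E)) fun s hs => ?_]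
      · simp
      · rw [uIcc_of_le (by linarith [hσ.1])] at hs
        exact hψ0 s hs.2
    rw [this, zero_add]
  rw [intervalIntegral.integral_add (hc.intervalIntegrable _ _) hηi, hswap,
    intervalIntegral.integral_congr (f := fun σ => ∫ t in (0 : ℝ)..b, T.realOp σ (ψ (t - σ)))
      (g := fun σ => T.realOp σ (φ (b - σ)) - T.realOp σ (φ 0)) fun σ hσ => ?_,
    intervalIntegral.integral_sub (f := fun σ => T.realOp σ (φ (b - σ)))
      ((T.continuous_realOp_comp continuous_id (by fun_prop)).intervalIntegrable _ _)
      (hc.intervalIntegrable _ _), add_sub_cancel]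
  · have := intervalIntegral.integral_comp_sub_left (a := 0) (b := b)
      (fun s => T.realOp (b - s) (φ s)) b
    simpa [C0Semigroup.duhamel] using this.symm
  · rw [uIcc_of_le hb] at hσ
    simp only [hinner σ hσ, map_sub]

end Regularity

section ClassicalRegularity

open MeasureTheory

variable {E : Type*} [NormedAddCommGroup E] [NormedSpace ℝ E] [CompleteSpace E]
  {T : C0Semigroup E} {A : E →ₗ.[ℝ] E}

/-- With a forcing term that is Lipschitz in time, the mild solution of the inhomogeneous equation
starting in the domain of the generator is the primitive of a continuous function. -/
lemma IsGenerator.exists_continuous_primitive (hE : LipschitzIsPrimitive E) (hA : IsGenerator A T)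
    {φ W : ℝ → E} {x₀ y : E} (hx₀ : (x₀, y) ∈ A.graph) (hφ : Continuous φ) {b : ℝ} (hb : 0 ≤ b)
    {K : ℝ≥0} (hK : LipschitzOnWith K φ (Icc 0 b))
    (hW : ∀ t, 0 ≤ t → W t = T.realOp t x₀ + T.duhamel φ t) :
    ∃ D : ℝ → E, Continuous D ∧ ∀ t ∈ Icc 0 b, W t = x₀ + ∫ s in (0 : ℝ)..t, D s := by
  obtain ⟨ψ, hψm, hψ, hψ0, hψφ⟩ := hE (fun s => φ (projIcc 0 b hb s)) (K * 1)
    (hK.to_restrict.comp (LipschitzWith.projIcc hb)) b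
  have hprim : ∀ t ∈ Icc 0 b, φ t - φ 0 = ∫ s in (0 : ℝ)..t, ψ s := by
    intro t ht
    have := hψφ t ht
    rwa [projIcc_of_mem hb ht, projIcc_of_mem hb (left_mem_Icc.2 hb)] at this
  let D₀ : ℝ → E := fun t =>
    T.realOp t y + (T.realOp t (φ 0) + ∫ σ in (0 : ℝ)..t, T.realOp σ (ψ (t - σ)))
  have hη := T.continuousOn_integral_realOp_comp_sub hψm hψ (b := b)
  have hcy := T.continuous_realOp_apply y
  have hc0 := T.continuous_realOp_apply (φ 0)
  have hD₀ : ContinuousOn D₀ (Icc 0 b) := hcy.continuousOn.add (hc0.continuousOn.add hη)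
  refine ⟨IccExtend hb ((Icc 0 b).domRestrict D₀), hD₀.domRestrict.Icc_extend', fun t ht => ?_⟩
  have hηi : IntervalIntegrable (fun r => T.realOp r (φ 0) +
      ∫ σ in (0 : ℝ)..r, T.realOp σ (ψ (r - σ))) volume 0 t :=
    ContinuousOn.intervalIntegrable (by
      rw [uIcc_of_le ht.1]
      exact (hc0.continuousOn.add hη).mono (Icc_subset_Icc_right ht.2))
  have h1 : ∫ s in (0 : ℝ)..t, IccExtend hb ((Icc 0 b).domRestrict D₀) s =
      ∫ s in (0 : ℝ)..t, D₀ s := by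
    refine intervalIntegral.integral_congr fun s hs => ?_
    rw [uIcc_of_le ht.1] at hs
    exact IccExtend_of_mem hb _ (Icc_subset_Icc_right ht.2 hs)
  rw [h1, hW t ht.1, intervalIntegral.integral_add (hcy.intervalIntegrable _ _) hηi,
    ← hA.realOp_sub_eq_integral hx₀ ht.1,
    T.duhamel_eq_integral hφ hψm hψ hψ0 ht.1 fun r hr => hprim r ⟨hr.1, hr.2.trans ht.2⟩]
  abel

/-- With a forcing term that is locally Lipschitz in time, the mild solution of the inhomogeneous
equation starting in the domain of the generator is a classical solution. -/
theorem IsGenerator.exists_classical (hE : LipschitzIsPrimitive E) (hA : IsGenerator A T)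
    {φ W : ℝ → E} {x₀ y : E} (hx₀ : (x₀, y) ∈ A.graph) (hφ : Continuous φ)
    (hK : ∀ b : ℝ, ∃ K : ℝ≥0, LipschitzOnWith K φ (Icc 0 b))
    (hW : ∀ t, 0 ≤ t → W t = T.realOp t x₀ + T.duhamel φ t) :
    ∃ W' : ℝ → E, ContinuousOn W' (Ici 0) ∧ ∀ t, 0 ≤ t →
      HasDerivWithinAt W (W' t) (Ici 0) t ∧ (W t, W' t - φ t) ∈ A.graph := by
  have hloc : ∀ b, 0 < b → ∃ D : ℝ → E, Continuous D ∧
      ∀ t ∈ Ico 0 b, HasDerivWithinAt W (D t) (Ici 0) t := by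
    intro b hb
    obtain ⟨K, hK⟩ := hK b
    obtain ⟨D, hD, h⟩ := hA.exists_continuous_primitive hE hx₀ hφ hb.le hK hW
    refine ⟨D, hD, fun t ht => ?_⟩
    have h1 : HasDerivWithinAt W (D t) (Icc 0 b) t :=
      (((hD.integral_hasStrictDerivAt 0 t).hasDerivAt.const_add x₀).hasDerivWithinAt).congr h
        (h t ⟨ht.1, ht.2.le⟩)
    refine h1.mono_of_mem_nhdsWithin ?_
    rw [← Ici_inter_Iic]
    exact inter_mem self_mem_nhdsWithin (mem_nhdsWithin_of_mem_nhds (Iic_mem_nhds ht.2))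
  have hder : ∀ t, 0 ≤ t → HasDerivWithinAt W (derivWithin W (Ici 0) t) (Ici 0) t := by
    intro t ht
    obtain ⟨D, -, h⟩ := hloc (t + 1) (by linarith)
    exact (h t ⟨ht, by linarith⟩).differentiableWithinAt.hasDerivWithinAt
  refine ⟨derivWithin W (Ici 0), fun t ht => ?_, fun t ht => ⟨hder t ht, ?_⟩⟩
  · have ht : 0 ≤ t := ht
    obtain ⟨D, hD, h⟩ := hloc (t + 1) (by linarith)
    have he : ∀ s ∈ Ico 0 (t + 1), derivWithin W (Ici 0) s = D s := fun s hs =>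
      (h s hs).derivWithin (uniqueDiffOn_Ici 0 s hs.1)
    refine (hD.continuousWithinAt (s := Ici 0)).congr_of_eventuallyEq ?_
      (he t ⟨ht, by linarith⟩)
    filter_upwards [self_mem_nhdsWithin,
      mem_nhdsWithin_of_mem_nhds (Iio_mem_nhds (lt_add_one t))] with s hs0 hs1
    exact he s ⟨hs0, hs1⟩
  · exact hA.mem_graph_of_hasDerivWithinAt hφ hW ht ((hder t ht).mono (Ici_subset_Ici.2 ht))

/-- Mild solutions of a semilinear equation starting in the domain of the generator are classical:
the forcing term `t ↦ F(w(t))` inherits Lipschitz continuity from the trajectory. -/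
theorem C0Semigroup.IsMild.exists_classical (hE : LipschitzIsPrimitive E) (hA : IsGenerator A T)
    {F : E → E} (hF : LipschitzOnBounded F) {w₀ y : E}
    (hw₀ : (w₀, y) ∈ A.graph) {w : C(ℝ≥0, E)} (h : T.IsMild F w₀ w) :
    ∃ W' : ℝ → E, ContinuousOn W' (Ici 0) ∧ ∀ t : ℝ≥0,
      HasDerivWithinAt (fun s : ℝ => w s.toNNReal) (W' t) (Ici 0) t ∧
        (w t, W' t - F (w t)) ∈ A.graph := by
  have hK : ∀ b : ℝ, ∃ K : ℝ≥0,
      LipschitzOnWith K (fun s : ℝ => F (w s.toNNReal)) (Icc 0 b) := by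
    intro b
    obtain ⟨K, hK⟩ := hF (w '' Icc 0 b.toNNReal)
      ((isCompact_Icc.image w.continuous).isBounded)
    have hmem : ∀ s ≤ b.toNNReal, w s ∈ w '' Icc 0 b.toNNReal := fun s hs =>
      mem_image_of_mem _ ⟨zero_le, hs⟩
    obtain ⟨L, hL⟩ := h.exists_lipschitzOnWith hA hF.continuous hK hw₀ hmem
    refine ⟨K * L, (hK.comp (hL.mono (Icc_subset_Icc_right (Real.le_coe_toNNReal b))) ?_)⟩
    exact fun s hs => hmem _ (Real.toNNReal_le_toNNReal hs.2)
  obtain ⟨W', h1, h2⟩ := hA.exists_classical hE (W := fun s : ℝ => w s.toNNReal) hw₀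
    (hF.continuous.comp w.continuous_comp_toNNReal) hK fun t ht => by
      have := h t.toNNReal
      rwa [Real.coe_toNNReal t ht] at this
  exact ⟨W', h1, fun t => by simpa using h2 t t.2⟩

end ClassicalRegularity

/-! ### Truncation by the radial retraction -/

section RadialRetraction

variable {E : Type*} [NormedAddCommGroup E] [NormedSpace ℝ E]

/-- The radial retraction of a normed space onto the closed ball of radius `R`. -/
noncomputable def radialRetraction (R : ℝ) (x : E) : E := (R / max R ‖x‖) • x

lemma radialRetraction_of_norm_le {R : ℝ} (hR : 0 < R) {x : E} (hx : ‖x‖ ≤ R) :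
    radialRetraction R x = x := by
  rw [radialRetraction, max_eq_left hx, div_self hR.ne', one_smul]

lemma norm_radialRetraction_le {R : ℝ} (hR : 0 < R) (x : E) : ‖radialRetraction R x‖ ≤ R := by
  have hm : 0 < max R ‖x‖ := lt_max_of_lt_left hR
  rw [radialRetraction, norm_smul, Real.norm_of_nonneg (by positivity), div_mul_eq_mul_div,
    div_le_iff₀ hm]
  gcongr
  exact le_max_right _ _

lemma lipschitzWith_radialRetraction {R : ℝ} (hR : 0 < R) :
    LipschitzWith 2 (radialRetraction R : E → E) := by
  refine LipschitzWith.of_dist_le_mul fun x y => ?_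
  rw [dist_eq_norm, dist_eq_norm]
  have hx : 0 < max R ‖x‖ := lt_max_of_lt_left hR
  have hy : 0 < max R ‖y‖ := lt_max_of_lt_left hR
  have h1 : radialRetraction R x - radialRetraction R y =
      (R / max R ‖x‖) • (x - y) + (R / max R ‖x‖ - R / max R ‖y‖) • y := by
    simp only [radialRetraction, smul_sub, sub_smul]; abel
  have h2 : R / max R ‖x‖ ≤ 1 := (div_le_one hx).2 (le_max_left _ _)
  have h3 : |max R ‖y‖ - max R ‖x‖| ≤ ‖x - y‖ := by
    have := abs_max_sub_max_le_abs ‖y‖ ‖x‖ R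
    rw [max_comm R, max_comm R]
    refine this.trans ?_
    rw [norm_sub_rev]
    exact abs_norm_sub_norm_le y x
  have h4 : |R / max R ‖x‖ - R / max R ‖y‖| * ‖y‖ ≤ ‖x - y‖ := by
    have e : R / max R ‖x‖ - R / max R ‖y‖ =
        R / max R ‖x‖ * ((max R ‖y‖ - max R ‖x‖) / max R ‖y‖) := by
      field_simp
    rw [e, abs_mul, abs_of_pos (div_pos hR hx), abs_div, abs_of_pos hy]
    calc _ ≤ 1 * (‖x - y‖ / max R ‖y‖) * max R ‖y‖ := by
          gcongr
          exact le_max_right _ _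
      _ = ‖x - y‖ := by field_simp
  rw [h1]
  refine (norm_add_le _ _).trans ?_
  rw [norm_smul, norm_smul, Real.norm_of_nonneg (by positivity), Real.norm_eq_abs]
  have h5 : R / max R ‖x‖ * ‖x - y‖ ≤ 1 * ‖x - y‖ := by gcongr
  push_cast
  linarith

lemma LipschitzOnBounded.exists_lipschitzWith_comp_radialRetraction {E₂ : Type*}
    [NormedAddCommGroup E₂] {F : E → E₂} (hF : LipschitzOnBounded F) {R : ℝ} (hR : 0 < R) :
    ∃ K : ℝ≥0, LipschitzWith K fun x => F (radialRetraction R x) := by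
  obtain ⟨K, hK⟩ := hF (Metric.closedBall 0 R) Metric.isBounded_closedBall
  refine ⟨K * 2, ?_⟩
  rw [← lipschitzOnWith_univ]
  exact hK.comp (lipschitzWith_radialRetraction hR).lipschitzOnWith fun x _ => by
    simpa using norm_radialRetraction_le hR x

end RadialRetraction

/-! ### Mild solutions for nonlinearities Lipschitz on bounded sets -/

section LocallyLipschitzMild

variable {E : Type*} [NormedAddCommGroup E] [NormedSpace ℝ E]
  {T : C0Semigroup E} {F : E → E}

/-- A mild solution of the truncated equation that stays in the ball solves the original one. -/
lemma C0Semigroup.IsMild.of_comp_radialRetraction {R : ℝ} (hR : 0 < R) {w₀ : E} {w : C(ℝ≥0, E)}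
    (h : T.IsMild (fun x => F (radialRetraction R x)) w₀ w) (hw : ∀ t, ‖w t‖ ≤ R) :
    T.IsMild F w₀ w := by
  intro t
  rw [h t]
  congr 1
  refine T.duhamel_congr t.coe_nonneg fun s _ => ?_
  simp only [radialRetraction_of_norm_le hR (hw _)]

variable [CompleteSpace E]

/-- Mild solutions taking values in a common bounded set depend continuously on the initial datum,
uniformly on bounded time intervals. -/
lemma C0Semigroup.exists_norm_sub_le (T : C0Semigroup E) (hF : LipschitzOnBounded F) (R : ℝ)
    (τ : ℝ≥0) : ∃ c : ℝ≥0, ∀ (w₀ w₀' : E) (w w' : C(ℝ≥0, E)), T.IsMild F w₀ w →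
      T.IsMild F w₀' w' → (∀ s ≤ τ, ‖w s‖ ≤ R) → (∀ s ≤ τ, ‖w' s‖ ≤ R) →
      ∀ t ≤ τ, ‖w t - w' t‖ ≤ c * ‖w₀ - w₀'‖ := by
  obtain ⟨m, hm1, hm⟩ := T.exists_norm_realOp_le τ
  obtain ⟨K, hK⟩ := hF (Metric.closedBall 0 R) Metric.isBounded_closedBall
  have hc : 0 ≤ m * Real.exp (m * K * τ) := by positivity
  refine ⟨(m * Real.exp (m * K * τ)).toNNReal, fun w₀ w₀' w w' h h' hw hw' t ht => ?_⟩
  refine (h.norm_sub_le hF.continuous hK hm h' (fun s hs => by simpa using hw s hs)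
    (fun s hs => by simpa using hw' s hs) ht).trans ?_
  rw [Real.coe_toNNReal _ hc]
  gcongr

lemma C0Semigroup.IsMild.unique (hF : LipschitzOnBounded F) {w₀ : E} {w w' : C(ℝ≥0, E)}
    (h : T.IsMild F w₀ w) (h' : T.IsMild F w₀ w') : w = w' := by
  ext t
  obtain ⟨R, hR⟩ := (isCompact_Icc (a := 0) (b := t)).exists_bound_of_continuousOn
    w.continuous.continuousOn
  obtain ⟨R', hR'⟩ := (isCompact_Icc (a := 0) (b := t)).exists_bound_of_continuousOn
    w'.continuous.continuousOn
  obtain ⟨c, hc⟩ := T.exists_norm_sub_le hF (max R R') t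
  have := hc w₀ w₀ w w' h h' (fun s hs => (hR s ⟨zero_le, hs⟩).trans (le_max_left _ _))
    (fun s hs => (hR' s ⟨zero_le, hs⟩).trans (le_max_right _ _)) t le_rfl
  rw [sub_self, norm_zero, mul_zero] at this
  exact sub_eq_zero.1 (norm_le_zero_iff.1 this)

end LocallyLipschitzMild

/-! ### The Lyapunov functional of the closed loop -/

section ForwardingFunctional

variable {X Y : Type*} [NormedAddCommGroup X] [NormedAddCommGroup Y]

/-- The forwarding Lyapunov functional `V(x) + (β / 2) ‖z - M(x)‖²`. -/
noncomputable def forwardingFunctional (V : X → ℝ) (β : ℝ) (M : X → Y) (w : X × Y) : ℝ :=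
  V w.1 + β / 2 * ‖w.2 - M w.1‖ ^ 2

/-- Sublevel sets are bounded: `V` controls `x`, hence `M(x)`, and the second term controls
`z - M(x)`. -/
lemma exists_norm_le_of_forwardingFunctional_le (hM : LipschitzOnBounded M) {V : X → ℝ} {m₁ β : ℝ}
    (hm₁ : 0 < m₁) (hβ : 0 < β) (hV : ∀ x, m₁ * ‖x‖ ^ 2 ≤ V x) (c : ℝ) :
    ∃ R : ℝ, 0 < R ∧ ∀ w : X × Y, forwardingFunctional V β M w ≤ c → ‖w‖ ≤ R := by
  obtain ⟨k, hk⟩ := hM.exists_norm_le (Metric.isBounded_closedBall (x := (0 : X))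
    (r := √(c / m₁)))
  refine ⟨√(c / m₁) + (√(c / (β / 2)) + k) + 1, by positivity, fun w hw => ?_⟩
  have h1 : 0 ≤ m₁ * ‖w.1‖ ^ 2 := by positivity
  have h2 : 0 ≤ β / 2 * ‖w.2 - M w.1‖ ^ 2 := by positivity
  have h3 := hV w.1
  unfold forwardingFunctional at hw
  have h4 : ‖w.1‖ ≤ √(c / m₁) := by
    refine Real.le_sqrt_of_sq_le ?_
    rw [le_div_iff₀ hm₁]
    linarith
  have h5 : ‖w.2 - M w.1‖ ≤ √(c / (β / 2)) := by
    refine Real.le_sqrt_of_sq_le ?_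
    rw [le_div_iff₀ (by positivity)]
    linarith
  have h6 := hk w.1 (by simpa using h4)
  have h7 : ‖w.2‖ ≤ ‖w.2 - M w.1‖ + ‖M w.1‖ := by
    simpa using norm_add_le (w.2 - M w.1) (M w.1)
  rw [Prod.norm_def]
  refine max_le ?_ ?_
  · have : 0 ≤ √(c / (β / 2)) := Real.sqrt_nonneg _
    linarith [k.coe_nonneg]
  · have : 0 ≤ √(c / m₁) := Real.sqrt_nonneg _
    linarith

lemma exists_forwardingFunctional_le (hM : LipschitzOnBounded M) {V : X → ℝ} {m₂ β : ℝ}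
    (hm₂ : 0 < m₂) (hβ : 0 < β) (hV : ∀ x, V x ≤ m₂ * ‖x‖ ^ 2) (r : ℝ) :
    ∃ c : ℝ, ∀ w : X × Y, ‖w‖ ≤ r → forwardingFunctional V β M w ≤ c := by
  obtain ⟨k, hk⟩ := hM.exists_norm_le (Metric.isBounded_closedBall (x := (0 : X)) (r := r))
  refine ⟨m₂ * r ^ 2 + β / 2 * (r + k) ^ 2, fun w hw => ?_⟩
  have h1 : ‖w.1‖ ≤ r := (norm_fst_le w).trans hw
  have h2 : ‖w.2‖ ≤ r := (norm_snd_le w).trans hw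
  have h3 := hk w.1 (by simpa using h1)
  refine add_le_add ((hV w.1).trans (by gcongr)) ?_
  gcongr
  exact (norm_sub_le _ _).trans (add_le_add h2 h3)

variable [NormedSpace ℝ X] [InnerProductSpace ℝ Y]

/-- The derivative of the forwarding functional along a direction `v` at `w`. -/
noncomputable def forwardingFunctionalDeriv (V : X → ℝ) (β : ℝ) (M : X → Y) (w v : X × Y) : ℝ :=
  fderiv ℝ V w.1 v.1 + β * inner ℝ (w.2 - M w.1) (v.2 - fderiv ℝ M w.1 v.1)

lemma hasDerivWithinAt_forwardingFunctional {V : X → ℝ} {β : ℝ} (hV : Differentiable ℝ V)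
    (hM : Differentiable ℝ M) {w : ℝ → X × Y} {v : X × Y} {s : Set ℝ} {t : ℝ}
    (hw : HasDerivWithinAt w v s t) :
    HasDerivWithinAt (fun r => forwardingFunctional V β M (w r))
      (forwardingFunctionalDeriv V β M (w t) v) s t := by
  have h1 : HasDerivWithinAt (fun r => (w r).1) v.1 s t :=
    (ContinuousLinearMap.fst ℝ X Y).hasFDerivAt.comp_hasDerivWithinAt t hw
  have h2 : HasDerivWithinAt (fun r => (w r).2) v.2 s t :=
    (ContinuousLinearMap.snd ℝ X Y).hasFDerivAt.comp_hasDerivWithinAt t hw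
  have h3 := (hV (w t).1).hasFDerivAt.comp_hasDerivWithinAt t h1
  have h4 := h2.fun_sub ((hM (w t).1).hasFDerivAt.comp_hasDerivWithinAt t h1)
  have h5 := h3.fun_add ((h4.norm_sq).const_mul (β / 2))
  refine h5.congr_deriv ?_
  simp only [forwardingFunctionalDeriv, Function.comp_apply]
  ring

end ForwardingFunctional

section InvariantGraph

variable {X Y : Type*} [NormedAddCommGroup X] [NormedSpace ℝ X] [NormedAddCommGroup Y]
  [NormedSpace ℝ Y] {A : X →ₗ.[ℝ] X} {f : X → X} {h : X → Y} {C : A.domain →ₗ[ℝ] Y}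
  {S : Y →L[ℝ] Y} {M : X → Y}

lemma IsInvariantGraph.differentiable (hM : IsInvariantGraph A f h C S M) : Differentiable ℝ M :=
  hM.contDiff.differentiable one_ne_zero

lemma IsInvariantGraph.lipschitzOnBounded (hM : IsInvariantGraph A f h C S M) :
    LipschitzOnBounded M :=
  LipschitzOnBounded.of_fderiv hM.differentiable hM.lipschitz_fderiv

end InvariantGraph

section ClosedLoop

variable {X Y U : Type*}
  [NormedAddCommGroup X] [InnerProductSpace ℝ X] [CompleteSpace X]
  [NormedAddCommGroup Y] [InnerProductSpace ℝ Y] [CompleteSpace Y]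
  [NormedAddCommGroup U] [InnerProductSpace ℝ U] [CompleteSpace U]
  {A : X →ₗ.[ℝ] X} {f : X → X} {g : X → U →L[ℝ] X} {h : X → Y} {C : A.domain →ₗ[ℝ] Y}
  {S : Y →L[ℝ] Y} {M : X → Y}

lemma lipschitzOnBounded_closedLoopNonlinearity (hf : LipschitzOnBounded f)
    (hg : LipschitzOnBounded g) (hh : LipschitzOnBounded h)
    (hM : IsInvariantGraph A f h C S M) :
    LipschitzOnBounded (closedLoopNonlinearity f g h S M) := by
  have h1 := LipschitzOnBounded.fst (E₁ := X) (E₂ := Y)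
  have h2 := LipschitzOnBounded.snd (E₁ := X) (E₂ := Y)
  have hu : LipschitzOnBounded fun w : X × Y => forwardingFeedback g M w.1 w.2 :=
    (hg.adjoint.comp h1).clm_apply
      ((hM.lipschitz_fderiv.adjoint.comp h1).clm_apply (h2.sub (hM.lipschitzOnBounded.comp h1)))
  exact ((hf.comp h1).add ((hg.comp h1).clm_apply hu)).prodMk
    (((LipschitzOnBounded.of_lipschitzWith S.lipschitz).comp h2).add (hh.comp h1))

/-- Along the closed loop the functional does not increase: the skew-adjoint part of the dynamics of
`z - M(x)` does no work, and the feedback dissipates exactly what the input costs. -/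
lemma forwardingFunctionalDeriv_nonpos (hS : ContinuousLinearMap.adjoint S = -S)
    (hM : IsInvariantGraph A f h C S M) {V : X → ℝ} {β : ℝ}
    (hV : ∀ (x : A.domain) (u : U), fderiv ℝ V (x : X) (A x + f x + g x u) ≤ β * ‖u‖ ^ 2)
    (x : A.domain) (z : Y) :
    forwardingFunctionalDeriv V β M ((x : X), z)
      ((A x, C x) + closedLoopNonlinearity f g h S M ((x : X), z)) ≤ 0 := by
  set u := forwardingFeedback g M (x : X) z with hu
  set e := z - M x with he
  have h1 : ((A x, C x) + closedLoopNonlinearity f g h S M ((x : X), z)) =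
      (A x + f x + g x u, S z + C x + h x) := by
    refine Prod.ext ?_ ?_
    · simp [closedLoopNonlinearity, hu, add_assoc]
    · simp only [closedLoopNonlinearity, Prod.snd_add]; abel
  have h2 : S z + C x + h x - fderiv ℝ M x (A x + f x + g x u) = S e - fderiv ℝ M x (g x u) := by
    rw [map_add, hM.sylvester, he, map_sub]; abel
  have h3 : inner ℝ e (S e) = 0 := by
    have := ContinuousLinearMap.adjoint_inner_left S e e
    rw [hS, neg_apply, inner_neg_left, real_inner_comm] at this
    linarith
  have h4 : inner ℝ e (fderiv ℝ M x (g x u)) = ‖u‖ ^ 2 := by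
    rw [← ContinuousLinearMap.adjoint_inner_left, ← ContinuousLinearMap.adjoint_inner_left,
      ← real_inner_self_eq_norm_sq]
    rfl
  rw [h1]
  simp only [forwardingFunctionalDeriv]
  rw [h2, inner_sub_right, h3, h4]
  linarith [hV x u]

/-! ### Global solutions of the closed loop -/

variable {T : C0Semigroup (X × Y)}

/-- Solutions of the truncated closed loop starting in the domain never reach the truncation
threshold, as long as that threshold bounds a sublevel set of the functional slightly larger than
that of the initial datum. -/
lemma norm_le_of_isMild_truncated (hT : IsGenerator (cascadeOperator A C) T)
    (hf : LipschitzOnBounded f) (hg : LipschitzOnBounded g) (hh : LipschitzOnBounded h)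
    (hS : ContinuousLinearMap.adjoint S = -S) (hM : IsInvariantGraph A f h C S M) {V : X → ℝ}
    {β : ℝ} (hVd : Differentiable ℝ V)
    (hV : ∀ (x : A.domain) (u : U), fderiv ℝ V (x : X) (A x + f x + g x u) ≤ β * ‖u‖ ^ 2)
    {w₀ : X × Y} (hw₀ : w₀.1 ∈ A.domain) {R : ℝ} (hR : 0 < R)
    (hN : ∀ v, forwardingFunctional V β M v ≤ forwardingFunctional V β M w₀ + 1 → ‖v‖ ≤ R)
    {w : C(ℝ≥0, X × Y)}
    (hw : T.IsMild (fun v => closedLoopNonlinearity f g h S M (radialRetraction R v)) w₀ w)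
    (t : ℝ≥0) : ‖w t‖ ≤ R := by
  obtain ⟨K, hK⟩ := (lipschitzOnBounded_closedLoopNonlinearity hf hg hh
    hM).exists_lipschitzWith_comp_radialRetraction hR
  obtain ⟨W', -, hW'⟩ := hw.exists_classical
    ((lipschitzIsPrimitive_of_hilbert X).prod (lipschitzIsPrimitive_of_hilbert Y)) hT
    (LipschitzOnBounded.of_lipschitzWith hK)
    (y := (A ⟨w₀.1, hw₀⟩, C ⟨w₀.1, hw₀⟩)) (mem_graph_cascadeOperator.2 ⟨⟨w₀.1, hw₀⟩, rfl, rfl⟩)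
  set τ : ℝ := t + 1 with hτ
  have hτ0 : 0 < τ := by positivity
  have hd : ∀ s ∈ Ici (0 : ℝ), HasDerivWithinAt
      (fun r : ℝ => forwardingFunctional V β M (w r.toNNReal))
      (forwardingFunctionalDeriv V β M (w s.toNNReal) (W' s)) (Ici 0) s := by
    intro s hs
    lift s to ℝ≥0 using hs
    have := hasDerivWithinAt_forwardingFunctional (β := β) hVd hM.differentiable (hW' s).1
    simpa using this
  -- Comparison with a barrier of positive slope requires the sign of the derivative only at the
  -- contact points; there the functional is at most its initial value plus `1`, so that the state
  -- lies in the ball on which the truncation is inactive.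
  have key := image_le_of_deriv_right_lt_deriv_boundary' (a := 0) (b := τ)
    (f := fun r : ℝ => forwardingFunctional V β M (w r.toNNReal))
    (f' := fun s => forwardingFunctionalDeriv V β M (w s.toNNReal) (W' s))
    (B := fun s => forwardingFunctional V β M w₀ + τ⁻¹ * s) (B' := fun _ => τ⁻¹)
    (fun s hs => (hd s hs.1).continuousWithinAt.mono Icc_subset_Ici_self)
    (fun s hs => (hd s hs.1).mono (Ici_subset_Ici.2 hs.1))
    (by simp [hw.apply_zero]) (by fun_prop)
    (fun s _ => by
      simpa using ((hasDerivAt_id' s).const_mul τ⁻¹).hasDerivWithinAt.const_add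
        (forwardingFunctional V β M w₀))
    (fun s hs he => by
      obtain ⟨hs0, hsτ⟩ := hs
      lift s to ℝ≥0 using hs0
      simp only [Real.toNNReal_coe] at he ⊢
      have h1 : ‖w s‖ ≤ R := by
        refine hN _ (he.le.trans ?_)
        gcongr
        rw [inv_mul_le_iff₀ hτ0]
        linarith
      obtain ⟨x, hx, hx'⟩ := mem_graph_cascadeOperator.1 (hW' s).2
      rw [sub_eq_iff_eq_add, radialRetraction_of_norm_le hR h1] at hx'
      have h2 := forwardingFunctionalDeriv_nonpos (g := g) hS hM hV x (w s).2
      rw [hx, Prod.mk.eta, ← hx'] at h2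
      exact h2.trans_lt (inv_pos.2 hτ0)) (x := t) ⟨t.coe_nonneg, by linarith⟩
  simp only [Real.toNNReal_coe] at key
  refine hN _ (key.trans ?_)
  gcongr
  rw [inv_mul_le_iff₀ hτ0]
  linarith

/-- Global mild solutions exist, with a bound depending only on the size of the initial datum. For
data in the domain this follows from the Lyapunov functional, and the bound passes to the limit. -/
theorem exists_isMild_closedLoop (hT : IsGenerator (cascadeOperator A C) T)
    (hf : LipschitzOnBounded f) (hg : LipschitzOnBounded g) (hh : LipschitzOnBounded h)
    (hS : ContinuousLinearMap.adjoint S = -S) (hISS : SemiglobalISS A f g)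
    (hM : IsInvariantGraph A f h C S M) (r : ℝ) :
    ∃ R : ℝ, ∀ w₀ : X × Y, ‖w₀‖ < r → ∃ w : C(ℝ≥0, X × Y),
      T.IsMild (closedLoopNonlinearity f g h S M) w₀ w ∧ ∀ t, ‖w t‖ ≤ R := by
  obtain ⟨V, ⟨hVc, m₁, m₂, hm₁, hm₂, hVb⟩, β, hβ, hV⟩ := hISS.global
  obtain ⟨c, hc⟩ := exists_forwardingFunctional_le hM.lipschitzOnBounded hm₂ hβ
    (fun x => (hVb x).2) r
  obtain ⟨R, hR, hN⟩ := exists_norm_le_of_forwardingFunctional_le hM.lipschitzOnBounded hm₁ hβ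
    (fun x => (hVb x).1) (c + 1)
  obtain ⟨K, hK⟩ := (lipschitzOnBounded_closedLoopNonlinearity hf hg hh
    hM).exists_lipschitzWith_comp_radialRetraction hR
  choose Ψ hΨ using T.exists_isMild hK
  have hdom : ∀ w₀ : X × Y, ‖w₀‖ < r → w₀.1 ∈ A.domain → ∀ t, ‖Ψ w₀ t‖ ≤ R := fun w₀ hr hw₀ =>
    norm_le_of_isMild_truncated hT hf hg hh hS hM (hVc.differentiable one_ne_zero) hV hw₀ hR
      (fun v hv => hN v (hv.trans (by gcongr; exact hc w₀ hr.le))) (hΨ w₀)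
  refine ⟨R, fun w₀ hr => ⟨Ψ w₀, ?_⟩⟩
  suffices hb : ∀ t, ‖Ψ w₀ t‖ ≤ R from ⟨(hΨ w₀).of_comp_radialRetraction hR hb, hb⟩
  intro t
  obtain ⟨m, hm1, hm⟩ := T.exists_norm_realOp_le t
  have hcont : Continuous fun v : X × Y => Ψ v t := by
    have hc : 0 ≤ m * Real.exp (m * K * t) := by positivity
    refine (LipschitzWith.of_dist_le_mul (K := (m * Real.exp (m * K * t)).toNNReal)
      fun v v' => ?_).continuous
    rw [dist_eq_norm, dist_eq_norm, Real.coe_toNNReal _ hc]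
    exact (hΨ v).norm_sub_le hK.continuous (hK.lipschitzOnWith (s := univ)) hm (hΨ v')
      (fun _ _ => mem_univ _) (fun _ _ => mem_univ _) le_rfl
  -- The bound is a closed condition, and it holds on the domain, which is dense.
  have hdense : w₀ ∈ closure (Metric.ball 0 r ∩ ((cascadeOperator A C).domain : Set (X × Y))) :=
    hT.dense_domain.open_subset_closure_inter Metric.isOpen_ball (by simpa using hr)
  have := map_mem_closure hcont hdense (t := Metric.closedBall 0 R) fun v hv => by
    simpa using hdom v (by simpa using hv.1) hv.2.1 t
  rw [Metric.isClosed_closedBall.closure_eq] at this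
  simpa using this

/-- Mild solutions of the closed loop starting in the domain are classical. -/
theorem isClosedLoopClassicalSolution_of_isMild (hT : IsGenerator (cascadeOperator A C) T)
    (hf : LipschitzOnBounded f) (hg : LipschitzOnBounded g) (hh : LipschitzOnBounded h)
    (hM : IsInvariantGraph A f h C S M) {w₀ : X × Y} (hw₀ : w₀.1 ∈ A.domain) {w : C(ℝ≥0, X × Y)}
    (hw : T.IsMild (closedLoopNonlinearity f g h S M) w₀ w) :
    IsClosedLoopClassicalSolution A f g h C S M w₀ w := by
  have hF := lipschitzOnBounded_closedLoopNonlinearity hf hg hh hM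
  obtain ⟨W', hW'c, hW'⟩ := hw.exists_classical
    ((lipschitzIsPrimitive_of_hilbert X).prod (lipschitzIsPrimitive_of_hilbert Y)) hT hF
    (y := (A ⟨w₀.1, hw₀⟩, C ⟨w₀.1, hw₀⟩))
    (mem_graph_cascadeOperator.2 ⟨⟨w₀.1, hw₀⟩, rfl, rfl⟩)
  have hd : ∀ s ∈ Ici (0 : ℝ),
      HasDerivWithinAt (fun s : ℝ => w s.toNNReal) (W' s) (Ici 0) s := by
    intro s hs
    lift s to ℝ≥0 using hs
    exact (hW' s).1
  choose x hx hxW using fun t : ℝ≥0 => mem_graph_cascadeOperator.1 (hW' t).2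
  have hW1 : ∀ t : ℝ≥0, W' t = (A (x t), C (x t)) + closedLoopNonlinearity f g h S M (w t) :=
    fun t => sub_eq_iff_eq_add.1 (hxW t)
  refine ⟨hw.apply_zero, ?_, x, fun t => (w t).2, fun t => Prod.ext (hx t).symm rfl, ?_,
    by fun_prop, fun t => ⟨?_, ?_⟩⟩
  · rw [contDiffOn_one_iff_derivWithin (uniqueDiffOn_Ici 0)]
    exact ⟨fun s hs => (hd s hs).differentiableWithinAt, hW'c.congr fun s hs =>
      (hd s hs).derivWithin (uniqueDiffOn_Ici 0 s hs)⟩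
  · have h1 : Continuous fun t : ℝ≥0 => W' t :=
      hW'c.comp_continuous NNReal.continuous_coe fun t => t.coe_nonneg
    have h2 : Continuous fun t : ℝ≥0 => (W' (t : ℝ) - closedLoopNonlinearity f g h S M (w t)).1 :=
      (h1.sub (hF.continuous.comp w.continuous)).fst
    have h3 : Continuous fun t => (x t : X) := by
      simp only [hx]
      fun_prop
    refine h3.prodMk (h2.congr fun t => ?_)
    rw [hxW]
  · have h1 : HasDerivWithinAt (fun s : ℝ => (w s.toNNReal).1) (W' t).1 (Ici 0) (t : ℝ) :=
      (ContinuousLinearMap.fst ℝ X Y).hasFDerivAt.comp_hasDerivWithinAt (t : ℝ) (hW' t).1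
    simp only [hx]
    refine h1.congr_deriv ?_
    rw [hW1]
    simp [closedLoopNonlinearity, add_assoc]
  · have h1 : HasDerivWithinAt (fun s : ℝ => (w s.toNNReal).2) (W' t).2 (Ici 0) (t : ℝ) :=
      (ContinuousLinearMap.snd ℝ X Y).hasFDerivAt.comp_hasDerivWithinAt (t : ℝ) (hW' t).1
    refine h1.congr_deriv ?_
    rw [hW1]
    simp only [closedLoopNonlinearity, Prod.snd_add, hx]
    abel

end ClosedLoop

theorem mainTheorem1 {X Y U : Type*}
    [NormedAddCommGroup X] [InnerProductSpace ℝ X] [CompleteSpace X]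
    [NormedAddCommGroup Y] [InnerProductSpace ℝ Y] [CompleteSpace Y]
    [NormedAddCommGroup U] [InnerProductSpace ℝ U] [CompleteSpace U]
    (A : X →ₗ.[ℝ] X) (hA : ∃ T : C0Semigroup X, IsGenerator A T)
    (f : X → X) (hf : LipschitzOnBounded f) (hf0 : f 0 = 0)
    (g : X → U →L[ℝ] X) (hg : LipschitzOnBounded g)
    (h : X → Y) (hh : LipschitzOnBounded h) (hh0 : h 0 = 0)
    (C : A.domain →ₗ[ℝ] Y) (hC : IsBoundedRelTo A C)
    (S : Y →L[ℝ] Y) (hS : ContinuousLinearMap.adjoint S = -S)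
    (hISS : SemiglobalISS A f g)
    (M : X → Y) (hM : IsInvariantGraph A f h C S M) :
    ∃ Φ : X × Y → C(ℝ≥0, X × Y),
      (∀ w₀ : X × Y, IsClosedLoopMildSolution A f g h C S M w₀ (Φ w₀) ∧
        ∀ w : C(ℝ≥0, X × Y), IsClosedLoopMildSolution A f g h C S M w₀ w → w = Φ w₀) ∧
      (∀ w₀ : X × Y, w₀.1 ∈ A.domain →
        IsClosedLoopClassicalSolution A f g h C S M w₀ (Φ w₀)) ∧
      (∀ τ : ℝ≥0, 0 < τ →
        Continuous fun w₀ : X × Y => (Φ w₀).restrict (Icc (0 : ℝ≥0) τ)) := by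
  obtain ⟨T₀, hT₀⟩ := hA
  have hT := hT₀.cascadeOperator hC
  have hF := lipschitzOnBounded_closedLoopNonlinearity hf hg hh hM
  have hbd := exists_isMild_closedLoop hT hf hg hh hS hISS hM
  have hex : ∀ w₀ : X × Y, ∃ w : C(ℝ≥0, X × Y),
      (hT₀.cascadeSemigroup hC).IsMild (closedLoopNonlinearity f g h S M) w₀ w := fun w₀ => by
    obtain ⟨R, hR⟩ := hbd (‖w₀‖ + 1)
    obtain ⟨w, hw, -⟩ := hR w₀ (lt_add_one _)
    exact ⟨w, hw⟩
  choose Φ hΦ using hex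
  refine ⟨Φ, fun w₀ => ⟨(isMildSolution_iff_isMild hT).2 (hΦ w₀), fun w hw => ?_⟩,
    fun w₀ hw₀ => isClosedLoopClassicalSolution_of_isMild hT hf hg hh hM hw₀ (hΦ w₀),
    fun τ _ => ?_⟩
  · exact ((isMildSolution_iff_isMild hT).1 hw).unique hF (hΦ w₀)
  · rw [continuous_iff_continuousAt]
    intro w₀
    obtain ⟨R, hR⟩ := hbd (‖w₀‖ + 1)
    have hΦR : ∀ v ∈ {v : X × Y | ‖v‖ < ‖w₀‖ + 1}, ∀ t, ‖Φ v t‖ ≤ R := fun v hv => by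
      obtain ⟨w, hw, hwR⟩ := hR v hv
      rwa [(hΦ v).unique hF hw]
    obtain ⟨c, hc⟩ := (hT₀.cascadeSemigroup hC).exists_norm_sub_le hF R τ
    have hLip : LipschitzOnWith c (fun v : X × Y => (Φ v).restrict (Icc (0 : ℝ≥0) τ))
        {v : X × Y | ‖v‖ < ‖w₀‖ + 1} := by
      refine LipschitzOnWith.of_dist_le_mul fun v hv v' hv' => ?_
      rw [ContinuousMap.dist_le (by positivity)]
      rintro ⟨t, ht⟩
      rw [dist_eq_norm, dist_eq_norm]
      exact hc v v' _ _ (hΦ v) (hΦ v') (fun s _ => hΦR v hv s) (fun s _ => hΦR v' hv' s) t ht.2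
    have hopen : IsOpen {v : X × Y | ‖v‖ < ‖w₀‖ + 1} := isOpen_lt continuous_norm continuous_const
    exact hLip.continuousOn.continuousAt (hopen.mem_nhds (lt_add_one ‖w₀‖))
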